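/- Let $X$ be a compact metrizable space with a compatible metric $\rho$, let $G$ be $\mathbb{Z}$ or $\mathbb{Z}_{\ge 0}$, and let $G$ act on $X$ by the powers of a continuous surjective map $T:X\to X$ (a homeomorphism if $G=\mathbb{Z}$). Definitions. A set $I\subseteq G$ has positive density if $\lim_{n\to\infty}\frac{|I\cap\{0,\dots,n\}|}{n+1}$ (for $G=\mathbb{Z}_{\ge0}$), respectively $\lim_{n\to\infty}\frac{|I\cap\{-n,\dots,n\}|}{2n+1}$ (for $G=\mathbb{Z}$), exists and is nonzero. A set $J\subseteq G$ is an independence set for a tuple $(A_1,\dots,A_k)$ of subsets of $X$ if $\bigcap_{s\in I}T^{-s}A_{\sigma(s)}\neq\emptyset$ for every nonempty finite $I\subseteq J$ and every $\sigma:I\to\{1,\dots,k\}$. A tuple $(x_1,\dots,x_k)\in X^k$ is an IE-tuple (an IE-pair if $k=2$) if for all neighbourhoods $U_1,\dots,U_k$ of $x_1,\dots,x_k$, respectively, the tuple $(U_1,\dots,U_k)$ has an independence set of positive density. A tuple is nondiagonal if its entries are not all equal. A Cantor set is a subset of $X$ homeomorphic to $\{0,1\}^{\mathbb{N}}$. A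 pair $(x,y)\in X^2$ is a Li–Yorke pair if $\limsup_{n\to\infty}\rho(T^nx,T^ny)>0$ and $\liminf_{n\to\infty}\rho(T^nx,T^ny)=0$. The system $(X,T)$ is Li–Yorke chaotic if $X$ contains an uncountable set in which every two distinct points form a Li–Yorke pair. Finally, $\mathrm{h}_{\mathrm{top}}(T)$ is the topological entropy of $T$, that is, the supremum over all open covers $\mathcal{U}$ of $X$ of $\lim_{n\to\infty}\frac1n\ln N(\mathcal{U}\vee T^{-1}\mathcal{U}\vee\cdots\vee T^{-n+1}\mathcal{U})$, where $N(\cdot)$ is the minimal cardinality of a subcover. Theorem. (A) Let $k\ge2$, let $(x_1,\dots,x_k)$ be a nondiagonal IE-tuple, and for each $1\le j\le k$ let $A_j$ be a neighbourhood of $x_j$. Then there are Cantor sets $Z_j\subseteq A_j$, $j=1,\dots,k$, such that, with $Z:=\bigcup_jZ_j$, (1) every nonempty finite tuple of points in $Z$ is an IE-tuple; (2) for all $m\ge1$, all distinct $y_1,\dots,y_m\in Z$ and all (not necessarily distinct) $y'_1,\dots,y'_m\in Z$ one has $\liminf_{n\to\infty}\max_{1\le i\le m}\rho(T^ny_i,y'_i)=0$.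 (B) If $\mathrm{h}_{\mathrm{top}}(T)>0$, then $(X,T)$ is Li–Yorke chaotic. (C) The set of Li–Yorke pairs that are IE-pairs is a dense subset of the set of nondiagonal IE-pairs. -/

import Mathlib

open Set Filter Topology

/-- A dynamical system generated by a single map on a space `X`: either the action of the additive
semigroup of nonnegative integers generated by a continuous surjection `T`, or the action of the
additive group of integers generated by a homeomorphism `T`. -/
inductive DynSys (X : Type*) [TopologicalSpace X] : Type _
  | nat (T : X → X) (continuous_T : Continuous T) (surjective_T : Function.Surjective T) : DynSys X
  | int (T : X ≃ₜ X) : DynSys X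

/-- The generating map `T` of the system. -/
def DynSys.map {X : Type*} [TopologicalSpace X] : DynSys X → X → X
  | .nat T _ _ => T
  | .int T => T

/-- Positive density of a subset of `ℤ_{≥ 0}`: the limit of `|I ∩ {0, …, n}| / (n + 1)` exists and
is nonzero. -/
def HasPosDensityNat (I : Set ℕ) : Prop :=
  ∃ d : ℝ, d ≠ 0 ∧
    Tendsto (fun n : ℕ => ((I ∩ Set.Icc 0 n).ncard : ℝ) / ((n : ℝ) + 1)) atTop (𝓝 d)

/-- Positive density of a subset of `ℤ`: the limit of `|I ∩ {-n, …, n}| / (2n + 1)` exists and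
is nonzero. -/
def HasPosDensityInt (I : Set ℤ) : Prop :=
  ∃ d : ℝ, d ≠ 0 ∧
    Tendsto (fun n : ℕ => ((I ∩ Set.Icc (-(n : ℤ)) (n : ℤ)).ncard : ℝ) / (2 * (n : ℝ) + 1))
      atTop (𝓝 d)

/-- `J ⊆ G` is an independence set for the tuple `A` (with respect to the maps `act s`, `s ∈ G`):
for every nonempty finite `I ⊆ J` and every `σ : I → {1, …, k}` the intersection
`⋂_{s ∈ I} s⁻¹ A_{σ(s)}` is nonempty. -/
def IsIndependenceSet {G X : Type*} (act : G → X → X) {k : ℕ} (A : Fin k → Set X)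
    (J : Set G) : Prop :=
  ∀ I : Finset G, I.Nonempty → (I : Set G) ⊆ J →
    ∀ σ : I → Fin k, (⋂ s : I, act s ⁻¹' A (σ s)).Nonempty

/-- The tuple `A` has an independence set of positive density in the acting semigroup. -/
def DynSys.HasPosDensityIndependenceSet {X : Type*} [TopologicalSpace X] {k : ℕ} :
    DynSys X → (Fin k → Set X) → Prop
  | .nat T _ _, A => ∃ J : Set ℕ, HasPosDensityNat J ∧ IsIndependenceSet (fun n : ℕ => T^[n]) A J
  | .int T, A => ∃ J : Set ℤ, HasPosDensityInt J ∧
      IsIndependenceSet (fun (n : ℤ) (x : X) => (T.toEquiv ^ n : Equiv.Perm X) x) A J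

/-- The set `IE_k(X, G)` of IE-tuples of length `k`. -/
def DynSys.IE {X : Type*} [TopologicalSpace X] (S : DynSys X) (k : ℕ) : Set (Fin k → X) :=
  {x | ∀ U : Fin k → Set X, (∀ i, U i ∈ 𝓝 (x i)) → S.HasPosDensityIndependenceSet U}

/-- The set of IE-pairs `IE_2(X, T)`, as a subset of `X × X`. -/
def DynSys.IEPairs {X : Type*} [TopologicalSpace X] (S : DynSys X) : Set (X × X) :=
  {p | ![p.1, p.2] ∈ S.IE 2}

/-- A Cantor set: a subspace homeomorphic to `{0, 1}^ℕ`. -/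
def IsCantorSet {X : Type*} [TopologicalSpace X] (Z : Set X) : Prop :=
  Nonempty (Z ≃ₜ (ℕ → Bool))

/-- `N(𝒱)`: the minimal cardinality of a (finite) subcover of the cover `𝒱`. -/
noncomputable def minSubcoverCard {X : Type*} (𝒱 : Set (Set X)) : ℕ :=
  sInf {m : ℕ | ∃ s : Finset (Set X), (s : Set (Set X)) ⊆ 𝒱 ∧
    ⋃₀ (s : Set (Set X)) = Set.univ ∧ s.card = m}

/-- The cover `𝒰 ∨ T⁻¹𝒰 ∨ ⋯ ∨ T^{-n+1}𝒰`. -/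
def iteratedJoin {X : Type*} (T : X → X) (𝒰 : Set (Set X)) (n : ℕ) : Set (Set X) :=
  Set.range fun V : Fin n → 𝒰 => ⋂ i : Fin n, T^[(i : ℕ)] ⁻¹' (V i : Set X)

/-- The topological entropy `h_top(T, 𝒰)` of an open cover, the limit of
`(1/n) ln N(𝒰 ∨ T⁻¹𝒰 ∨ ⋯ ∨ T^{-n+1}𝒰)`. The sequence `ln N(⋯)` is subadditive, so that the limit
exists and agrees with the limit superior. -/
noncomputable def coverTopEntropy {X : Type*} (T : X → X) (𝒰 : Set (Set X)) : EReal :=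
  limsup (fun n : ℕ => ((Real.log (minSubcoverCard (iteratedJoin T 𝒰 n)) / n : ℝ) : EReal)) atTop

/-- The topological entropy `h_top(T)`: the supremum of `h_top(T, 𝒰)` over all open covers. -/
noncomputable def topEntropy {X : Type*} [TopologicalSpace X] (T : X → X) : EReal :=
  ⨆ 𝒰 ∈ {𝒰 : Set (Set X) | (∀ U ∈ 𝒰, IsOpen U) ∧ ⋃₀ 𝒰 = Set.univ}, coverTopEntropy T 𝒰

/-- The set `LY(X, T)` of Li-Yorke pairs. -/
def liYorkePairs {X : Type*} [MetricSpace X] (T : X → X) : Set (X × X) :=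
  {p | 0 < limsup (fun n : ℕ => dist (T^[n] p.1) (T^[n] p.2)) atTop ∧
    liminf (fun n : ℕ => dist (T^[n] p.1) (T^[n] p.2)) atTop = 0}

/-- A set is scrambled if all nondiagonal pairs of its points are Li-Yorke pairs. -/
def IsScrambled {X : Type*} [MetricSpace X] (T : X → X) (Z : Set X) : Prop :=
  ∀ x ∈ Z, ∀ y ∈ Z, x ≠ y → (x, y) ∈ liYorkePairs T

/-- The system is Li-Yorke chaotic if `X` contains an uncountable scrambled set. -/
def IsLiYorkeChaotic {X : Type*} [MetricSpace X] (T : X → X) : Prop :=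
  ∃ Z : Set X, ¬ Z.Countable ∧ IsScrambled T Z

/-! Everything rests on a finitary notion. `PosIndep T A` asks, for some c > 0 and infinitely many
n, for an independence set in {0, …, n - 1} with at least c n elements. By `DynSys.mem_IE_iff` it
defines the same IE-tuples as independence sets of exact density. Exact density is recovered because
the maximal size of an independence set in an interval is subadditive: a set nearly attaining the
limiting rate d is seen from most of its points with density close to d in all long windows, and
re-centred copies converge to an infinite set of density d on both sides.

Three operations preserve `PosIndep`. Each member may be replaced by its part in some piece of a
finite cover (`PosIndep.exists_inter`), by a weighted Sauer–Shelah argument. Members may be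
intersected with preimages of members under late iterates, simultaneously for all prescriptions
(`PosIndep.exists_iInter_preimage`), because a pattern of E inside blocks of bounded length recurs
with positive frequency. Finally, closed sets can be shrunk to points whose neighbourhoods are all
`PosIndep` (`PosIndep.exists_points`), by compactness.

For (A), a tree of closed sets is built by `PosIndep.exists_refinement`: each set splits into two
small subsets, and every assignment of sets of the new level to sets of the old one is realised by a
single late iterate of T. Branches give points. All levels being `PosIndep` gives (1), and the
assignments give (2).

For distinct points y, z of the Cantor sets, approaching (y, z) bounds the limsup from below and
approaching (y, y) makes the liminf zero, so (y, z) is a Li–Yorke pair. This gives (C), and also (B)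
once positive entropy yields a nondiagonal IE-pair. For the latter, orbit segments are encoded by
their visits to balls around a finite net. If no two sets {dist(·, p) ≤ a} and {dist(·, p) ≥ b} with
a < b were `PosIndep`, Sauer–Shelah would make the number of codes subexponential. -/

/-! ### Weighted Sauer–Shelah inequalities -/

/-- The family `S` of words of length `n` shatters the partial type assignment `τ`: every choice of
letters `v i` in the sets `C t` with `τ i = some t` is realised by a word in `S`. -/
def ShattersTypes {L K : Type*} (C : K → Set L) {n : ℕ} (S : Set (Fin n → L))
    (τ : Fin n → Option K) : Prop :=
  ∀ v : Fin n → L, (∀ i t, τ i = some t → v i ∈ C t) →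
    ∃ s ∈ S, ∀ i t, τ i = some t → s i = v i

section
open scoped Classical in
/-- A weighted Sauer–Shelah inequality for several types of shattering. -/
theorem sum_weight_le_sum_shattersTypes {L K : Type*} [Fintype L] [Fintype K] (C : K → Set L)
    (m : L → ℝ) (hm : ∀ l, 0 ≤ m l) (α : ℝ) (hα : 0 ≤ α)
    (h : ∀ B : Set L, (∀ t, ¬ C t ⊆ B) → ∑ l, (if l ∈ B then m l else 0) ≤ α) (n : ℕ)
    (S : Set (Fin n → L)) :
    ∑ s : Fin n → L, (if s ∈ S then ∏ i, m (s i) else 0) ≤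
      ∑ τ : Fin n → Option K,
        (if ShattersTypes C S τ then ∏ i, (τ i).elim α (fun _ => ∑ l, m l) else 0) := by
  have hγ : 0 ≤ ∑ l, m l := Finset.sum_nonneg fun l _ => hm l
  have hw : ∀ o : Option K, 0 ≤ o.elim α (fun _ => ∑ l, m l) := by
    intro o; cases o <;> simp [hα, hγ]
  induction n with
  | zero =>
    simp only [Finset.univ_unique, Finset.sum_singleton, Finset.univ_eq_empty, Finset.prod_empty]
    by_cases hS : default ∈ S
    · have hsh : ∀ τ, ShattersTypes C S τ := fun τ v _ => ⟨default, hS, fun i => i.elim0⟩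
      rw [if_pos hS]
      split_ifs with h'
      · simp
      · exact absurd (hsh _) h'
    · rw [if_neg hS]; split_ifs <;> norm_num
  | succ n ih =>
    rw [← (Fin.consEquiv fun _ : Fin (n + 1) => L).sum_comp,
      ← (Fin.consEquiv fun _ : Fin (n + 1) => Option K).sum_comp, Fintype.sum_prod_type,
      Fintype.sum_prod_type]
    simp only [Fin.consEquiv, Equiv.coe_fn_mk, Fin.prod_univ_succ, Fin.cons_zero, Fin.cons_succ]
    let W : (Fin n → Option K) → ℝ := fun τ => ∏ i, (τ i).elim α (fun _ => ∑ l, m l)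
    have hW : ∀ τ, 0 ≤ W τ := fun τ => Finset.prod_nonneg fun i _ => hw _
    -- Slice by the first letter. For a fixed τ on the tail, let B be the letters whose slice
    -- shatters τ. If B contains some `C t`, then τ extended by t is shattered and its factor, the
    -- full weight, pays for B. Otherwise B weighs at most α, and if B is nonempty the extension by
    -- `none` is shattered and pays.
    let Sl : L → Set (Fin n → L) := fun l => {s | (Fin.cons l s : Fin (n + 1) → L) ∈ S}
    calc ∑ l, ∑ s : Fin n → L, (if (Fin.cons l s : Fin (n + 1) → L) ∈ S then
            m l * ∏ i, m (s i) else 0)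
        = ∑ l, m l * ∑ s : Fin n → L, (if s ∈ Sl l then ∏ i, m (s i) else 0) := by
          refine Finset.sum_congr rfl fun l _ => ?_
          rw [Finset.mul_sum]
          refine Finset.sum_congr rfl fun s _ => ?_
          simp [Sl, mul_ite]
      _ ≤ ∑ l, m l * ∑ τ, (if ShattersTypes C (Sl l) τ then W τ else 0) :=
          Finset.sum_le_sum fun l _ => mul_le_mul_of_nonneg_left (ih (Sl l)) (hm l)
      _ = ∑ τ, W τ * ∑ l, (if l ∈ {l | ShattersTypes C (Sl l) τ} then m l else 0) := by
          simp only [Finset.mul_sum]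
          rw [Finset.sum_comm]
          refine Finset.sum_congr rfl fun τ _ => Finset.sum_congr rfl fun l _ => ?_
          simp only [mem_ofPred_eq]
          split_ifs <;> ring
      _ ≤ ∑ τ, ∑ o : Option K, (if ShattersTypes C S (Fin.cons o τ : Fin (n + 1) → Option K) then
            o.elim α (fun _ => ∑ l, m l) * W τ else 0) := by
          refine Finset.sum_le_sum fun τ _ => ?_
          rw [Fintype.sum_option]
          set B := {l | ShattersTypes C (Sl l) τ} with hB
          have hnn : ∀ o : Option K, 0 ≤ (if ShattersTypes C S
              (Fin.cons o τ : Fin (n + 1) → Option K) then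
              o.elim α (fun _ => ∑ l, m l) * W τ else 0) := by
            intro o; split_ifs
            · exact mul_nonneg (hw o) (hW τ)
            · exact le_rfl
          by_cases hC : ∃ t, C t ⊆ B
          · obtain ⟨t, ht⟩ := hC
            have hsh : ShattersTypes C S (Fin.cons (some t) τ : Fin (n + 1) → Option K) := by
              intro v hv
              have h0 : v 0 ∈ B := ht (hv 0 t (by simp))
              obtain ⟨s, hs, hsv⟩ := h0 (fun i => v i.succ) (fun i u hu => hv i.succ u (by simpa))
              refine ⟨Fin.cons (v 0) s, hs, fun i u hu => ?_⟩
              refine Fin.cases (by simp) (fun i hu => ?_) i hu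
              simpa using hsv i u (by simpa using hu)
            have h1 : W τ * ∑ l, (if l ∈ B then m l else 0) ≤ (∑ l, m l) * W τ := by
              rw [mul_comm]
              refine mul_le_mul_of_nonneg_right (Finset.sum_le_sum fun l _ => ?_) (hW τ)
              split_ifs
              · exact le_rfl
              · exact hm l
            have h2 := Finset.single_le_sum (f := fun t : K => if ShattersTypes C S
              (Fin.cons (some t) τ : Fin (n + 1) → Option K) then
              (some t).elim α (fun _ => ∑ l, m l) * W τ else 0)
              (fun t _ => hnn (some t)) (Finset.mem_univ t)
            rw [if_pos hsh] at h2
            have h3 := hnn none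
            simp only [Option.elim] at h2 h3 ⊢
            linarith
          · push Not at hC
            have h2 : 0 ≤ ∑ t : K, (if ShattersTypes C S
              (Fin.cons (some t) τ : Fin (n + 1) → Option K) then
              (some t).elim α (fun _ => ∑ l, m l) * W τ else 0) :=
              Finset.sum_nonneg fun t _ => hnn (some t)
            by_cases hne : B.Nonempty
            · obtain ⟨l, hl⟩ := hne
              have hsh : ShattersTypes C S (Fin.cons none τ : Fin (n + 1) → Option K) := by
                intro v hv
                obtain ⟨s, hs, hsv⟩ := hl (fun i => v i.succ)
                  (fun i u hu => hv i.succ u (by simpa))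
                refine ⟨Fin.cons l s, hs, fun i u hu => ?_⟩
                refine Fin.cases (fun hu => by simp at hu) (fun i hu => ?_) i hu
                simpa using hsv i u (by simpa using hu)
              rw [if_pos hsh, mul_comm (W τ)]
              have := mul_le_mul_of_nonneg_right (h B hC) (hW τ)
              simp only [Option.elim] at h2 ⊢
              linarith
            · have h3 := hnn none
              have h4 : ∑ l, (if l ∈ B then m l else 0) = 0 :=
                Finset.sum_eq_zero fun l _ => if_neg fun hl => hne ⟨l, hl⟩
              rw [h4, mul_zero]
              linarith
      _ = _ := Finset.sum_comm
end

open scoped Classical in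
/-- A family of words of large total weight shatters a partial type assignment with linearly many
assigned types. -/
theorem exists_shattersTypes_card_ge {L K : Type*} [Fintype L] [Fintype K] (C : K → Set L)
    (m : L → ℝ) (hm : ∀ l, 0 ≤ m l) (α β : ℝ) (hα : 0 ≤ α) (hαβ : α < β)
    (h : ∀ B : Set L, (∀ t, ¬ C t ⊆ B) → ∑ l, (if l ∈ B then m l else 0) ≤ α) :
    ∃ c : ℝ, 0 < c ∧ ∀ n : ℕ, 0 < n → ∀ S : Set (Fin n → L),
      β ^ n ≤ ∑ s : Fin n → L, (if s ∈ S then ∏ i, m (s i) else 0) →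
      ∃ τ : Fin n → Option K, ShattersTypes C S τ ∧
        c * n ≤ (Finset.univ.filter fun i => τ i ≠ none).card := by
  set γ := ∑ l, m l with hγdef
  have hγ : 0 ≤ γ := Finset.sum_nonneg fun l _ => hm l
  set r : ℝ := (Fintype.card K : ℝ) with hrdef
  have hr : 0 ≤ r := Nat.cast_nonneg _
  -- Chernoff-type tilt: discounting each assigned position by x makes the sum over all τ equal to δ
  -- ^ n with δ < β. Undoing the discount at fewer than c n positions costs at most x ^ (-c n),
  -- harmless for small c.
  obtain ⟨x, hx0, hx1, hx⟩ : ∃ x : ℝ, 0 < x ∧ x < 1 ∧ α + r * (γ * x) < β := by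
    have hc : Tendsto (fun x : ℝ => α + r * (γ * x)) (𝓝[>] 0) (𝓝 (α + r * (γ * 0))) :=
      (Continuous.tendsto (by fun_prop) 0).mono_left nhdsWithin_le_nhds
    have h1 := hc.eventually (gt_mem_nhds (by simpa using hαβ : α + r * (γ * 0) < β))
    have h2 : ∀ᶠ x : ℝ in 𝓝[>] 0, x ∈ Ioo (0 : ℝ) 1 := Ioo_mem_nhdsGT one_pos
    obtain ⟨x, ha, hb⟩ := (h1.and h2).exists
    exact ⟨x, hb.1, hb.2, ha⟩
  set δ := α + r * (γ * x) with hδ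
  have hδ0 : 0 ≤ δ := by positivity
  obtain ⟨c, hc0, hc⟩ : ∃ c : ℝ, 0 < c ∧ δ * x ^ (-c) < β := by
    have hcont : Tendsto (fun c : ℝ => δ * x ^ (-c)) (𝓝[>] 0) (𝓝 (δ * x ^ (-(0 : ℝ)))) := by
      refine (Continuous.tendsto ?_ 0).mono_left nhdsWithin_le_nhds
      have := Real.continuous_const_rpow hx0.ne'
      fun_prop
    have h1 := hcont.eventually (gt_mem_nhds (by simpa using hx : δ * x ^ (-(0 : ℝ)) < β))
    obtain ⟨c, ha, hb⟩ := (h1.and self_mem_nhdsWithin).exists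
    exact ⟨c, hb, ha⟩
  refine ⟨c, hc0, fun n hn S hS => ?_⟩
  by_contra! hcon
  have key := hS.trans (sum_weight_le_sum_shattersTypes C m hm α hα h n S)
  have hw : ∀ o : Option K, 0 ≤ o.elim α (fun _ => γ * x) := by
    intro o; cases o
    · exact hα
    · exact mul_nonneg hγ hx0.le
  have h2 : ∀ τ : Fin n → Option K, (if ShattersTypes C S τ then
      ∏ i, (τ i).elim α (fun _ => γ) else 0) ≤
      (x ^ (-c)) ^ n * ∏ i, (τ i).elim α (fun _ => γ * x) := by
    intro τ
    have hp : 0 ≤ (x ^ (-c)) ^ n := pow_nonneg (Real.rpow_nonneg hx0.le _) _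
    have hq : 0 ≤ ∏ i, (τ i).elim α (fun _ => γ * x) := Finset.prod_nonneg fun i _ => hw _
    split_ifs with hτ
    · have hcard := hcon τ hτ
      have e : ∏ i, (τ i).elim α (fun _ => γ * x) =
          (∏ i, (τ i).elim α (fun _ => γ)) * x ^ (Finset.univ.filter fun i => τ i ≠ none).card := by
        rw [← Finset.prod_const, Finset.prod_filter, ← Finset.prod_mul_distrib]
        refine Finset.prod_congr rfl fun i _ => ?_
        cases τ i <;> simp
      have hq' : 0 ≤ ∏ i, (τ i).elim α (fun _ => γ) := Finset.prod_nonneg fun i _ => by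
        cases τ i
        · exact hα
        · exact hγ
      rw [e, ← Real.rpow_natCast x, ← Real.rpow_natCast, ← Real.rpow_mul hx0.le, mul_left_comm,
        ← Real.rpow_add hx0]
      refine le_mul_of_one_le_right hq' (Real.one_le_rpow_of_pos_of_le_one_of_nonpos hx0 hx1.le ?_)
      linarith
    · exact mul_nonneg hp hq
  have h3 : β ^ n ≤ (x ^ (-c)) ^ n * δ ^ n := by
    refine key.trans ((Finset.sum_le_sum fun τ _ => h2 τ).trans (le_of_eq ?_))
    rw [← Finset.mul_sum]
    congr 1
    have := Finset.prod_univ_sum (ι := Fin n) (fun _ => (Finset.univ : Finset (Option K)))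
      (fun _ o => o.elim α (fun _ => γ * x))
    rw [Fintype.piFinset_univ] at this
    rw [← this, Finset.prod_const, Fintype.sum_option]
    simp [hδ, hrdef]
  rw [← mul_pow, mul_comm] at h3
  have : (δ * x ^ (-c)) ^ n < β ^ n :=
    pow_lt_pow_left₀ hc (mul_nonneg hδ0 (Real.rpow_nonneg hx0.le _)) hn.ne'
  linarith

/-! ### Positive independence density: partitions and return times -/

theorem Filter.Frequently.exists_of_finite {α β : Type*} [Finite β] {f : Filter α}
    {p : α → β → Prop} (h : ∃ᶠ a in f, ∃ b, p a b) : ∃ b, ∃ᶠ a in f, p a b := by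
  by_contra hcon
  simp only [not_exists, not_frequently] at hcon
  exact h ((eventually_all.2 hcon).mono fun a ha => by simpa using ha)

/-- `E` is a (finite) independence set for the tuple `A` under the iterates of `T`. -/
def IndepOn {X ι : Type*} (T : X → X) (A : ι → Set X) (E : Finset ℕ) : Prop :=
  ∀ σ : ℕ → ι, ∃ x, ∀ s ∈ E, T^[s] x ∈ A (σ s)

/-- The tuple `A` has arbitrarily long independence sets of density bounded below. -/
def PosIndep {X ι : Type*} (T : X → X) (A : ι → Set X) : Prop :=
  ∃ c : ℝ, 0 < c ∧ ∃ᶠ n : ℕ in atTop, ∃ E ⊆ Finset.range n, c * n ≤ E.card ∧ IndepOn T A E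

theorem IndepOn.mono {X ι κ : Type*} {T : X → X} {A : ι → Set X} {B : κ → Set X} {E F : Finset ℕ}
    (f : κ → ι) (h : IndepOn T A E) (hAB : ∀ i, A (f i) ⊆ B i) (hFE : F ⊆ E) : IndepOn T B F :=
  fun σ => (h (fun s => f (σ s))).imp fun _ hx s hs => hAB _ (hx s (hFE hs))

theorem PosIndep.mono {X ι κ : Type*} {T : X → X} {A : ι → Set X} {B : κ → Set X}
    (f : κ → ι) (h : PosIndep T A) (hAB : ∀ i, A (f i) ⊆ B i) : PosIndep T B := by
  obtain ⟨c, hc, h⟩ := h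
  exact ⟨c, hc, h.mono fun n ⟨E, hE, hcE, hi⟩ => ⟨E, hE, hcE, hi.mono f hAB subset_rfl⟩⟩

theorem PosIndep.nonempty {X ι : Type*} {T : X → X} {A : ι → Set X} (h : PosIndep T A) (i : ι) :
    (A i).Nonempty := by
  obtain ⟨c, hc, h⟩ := h
  obtain ⟨n, ⟨E, -, hcE, hi⟩, hn⟩ := (h.and_eventually (eventually_gt_atTop 0)).exists
  have : 0 < E.card := by
    have : (0 : ℝ) < E.card := lt_of_lt_of_le (by positivity) hcE
    exact_mod_cast this
  obtain ⟨s, hs⟩ := Finset.card_pos.1 this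
  obtain ⟨x, hx⟩ := hi fun _ => i
  exact ⟨_, hx s hs⟩

open scoped Classical in
theorem sum_prod_le_sum_ite_mem_range {n : ℕ} {V L : Type*} [Fintype V] [Fintype L] (m : L → ℝ)
    (hm : ∀ y, 0 ≤ m y) (w : V → Fin n → L) (hw : Function.Injective w) :
    ∑ σ, ∏ i, m (w σ i) ≤ ∑ s : Fin n → L, (if s ∈ range w then ∏ i, m (s i) else 0) := by
  calc ∑ σ, ∏ i, m (w σ i) = ∑ s ∈ Finset.univ.map ⟨w, hw⟩, ∏ i, m (s i) := by
        simp only [Finset.sum_map, Function.Embedding.coeFn_mk]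
    _ = ∑ s ∈ Finset.univ.map ⟨w, hw⟩, if s ∈ range w then ∏ i, m (s i) else 0 := by
        refine Finset.sum_congr rfl fun s hs => (if_pos ?_).symm
        obtain ⟨σ, -, rfl⟩ := Finset.mem_map.1 hs
        exact mem_range_self σ
    _ ≤ _ := by
        refine Finset.sum_le_sum_of_subset_of_nonneg (Finset.subset_univ _) fun s _ _ => ?_
        split_ifs
        · exact Finset.prod_nonneg fun i _ => hm _
        · exact le_rfl

/-- If each word `σ` over `ι` carries a word `pc σ` over `κ`, then there are a letter `l` of `κ` and
linearly many positions on which every word over `ι` is realised by some `σ` with `pc σ = l`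
wherever `σ` has the letter `i₀`. -/
theorem exists_realize_words_of_coloring (ι κ : Type*) [Finite ι] [Finite κ] (i₀ : ι) :
    ∃ c : ℝ, 0 < c ∧ ∀ n : ℕ, 0 < n → ∀ pc : (Fin n → ι) → Fin n → κ,
      ∃ (l : κ) (J : Finset (Fin n)), c * n ≤ J.card ∧
        ∀ ρ : Fin n → ι, ∃ σ : Fin n → ι, ∀ i ∈ J, σ i = ρ i ∧ (ρ i = i₀ → pc σ i = l) := by
  classical
  cases nonempty_fintype ι
  cases nonempty_fintype κ
  set r : ℝ := (Fintype.card κ : ℝ) with hr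
  have hr0 : 0 ≤ r := Nat.cast_nonneg _
  let g : ι → ℝ := fun i => if i = i₀ then 0 else r
  have hg : ∀ i, 0 ≤ g i := fun i => by simp only [g]; split_ifs <;> simp [hr0]
  have hg0 : 0 ≤ ∑ i, g i := Finset.sum_nonneg fun i _ => hg i
  -- A position carrying i₀ is recorded by its colour, any other letter by itself. Letters other
  -- than i₀ weigh r, as much as all colours together, so a set containing no `C t` weighs at most ∑
  -- g: it misses such a letter or it misses every colour. The encoded words weigh (∑ g + 1) ^ n in
  -- total, which is exponentially more.
  let C : κ → Set (κ ⊕ ι) := fun t => insert (Sum.inl t) {y | ∃ i, i ≠ i₀ ∧ y = Sum.inr i}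
  let m : κ ⊕ ι → ℝ := Sum.elim (fun _ => 1) g
  have hm : ∀ y, 0 ≤ m y := by
    rintro (l | i)
    · exact zero_le_one
    · exact hg i
  have hD : ∀ D : Set (κ ⊕ ι), (∀ t, ¬ C t ⊆ D) →
      ∑ y, (if y ∈ D then m y else 0) ≤ ∑ i, g i + 1 / 2 := by
    intro D hD
    rw [Fintype.sum_sum_type]
    simp only [m, Sum.elim_inl, Sum.elim_inr]
    by_cases hi : ∃ i, i ≠ i₀ ∧ Sum.inr i ∉ D
    · obtain ⟨i₁, hi₁, hiD⟩ := hi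
      have h1 : ∑ l : κ, (if (Sum.inl l : κ ⊕ ι) ∈ D then (1 : ℝ) else 0) ≤ r := by
        calc _ ≤ ∑ _l : κ, (1 : ℝ) := Finset.sum_le_sum fun l _ => by split_ifs <;> norm_num
          _ = r := by simp [hr]
      have h2 : ∑ i, (if (Sum.inr i : κ ⊕ ι) ∈ D then g i else 0) ≤
          ∑ i, (g i - if i = i₁ then r else 0) := by
        refine Finset.sum_le_sum fun i _ => ?_
        by_cases hii : i = i₁
        · subst hii; simp [hiD, g, hi₁]
        · simp only [hii, if_false, sub_zero]
          split_ifs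
          · exact le_rfl
          · exact hg i
      rw [Finset.sum_sub_distrib, Finset.sum_ite_eq' Finset.univ i₁, if_pos (Finset.mem_univ _)]
        at h2
      linarith
    · push Not at hi
      have h1 : ∑ l : κ, (if (Sum.inl l : κ ⊕ ι) ∈ D then (1 : ℝ) else 0) = 0 := by
        refine Finset.sum_eq_zero fun l _ => if_neg fun hl => hD l ?_
        rintro y (rfl | ⟨i, hi', rfl⟩)
        · exact hl
        · exact hi i hi'
      have h2 : ∑ i, (if (Sum.inr i : κ ⊕ ι) ∈ D then g i else 0) ≤ ∑ i, g i := by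
        refine Finset.sum_le_sum fun i _ => ?_
        split_ifs
        · exact le_rfl
        · exact hg i
      linarith
  obtain ⟨c, hc, hsh⟩ := exists_shattersTypes_card_ge C m hm
    (∑ i, g i + 1 / 2) (∑ i, g i + 1) (by positivity) (by norm_num)
    (fun D h => by convert hD D h)
  refine ⟨c / (r + 1), by positivity, fun n hn pc => ?_⟩
  let w : (Fin n → ι) → (Fin n → κ ⊕ ι) := fun σ i =>
    if σ i = i₀ then Sum.inl (pc σ i) else Sum.inr (σ i)
  have hw : Function.Injective w := by
    intro σ σ' hσ
    funext i
    have := congrFun hσ i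
    simp only [w] at this
    split_ifs at this with h1 h2 h2
    · rw [h1, h2]
    · exact Sum.inr_injective this
  have hS : (∑ i, g i + 1) ^ n = ∑ σ, ∏ i, m (w σ i) := by
    have h1 : ∀ σ : Fin n → ι, ∏ i, m (w σ i) = ∏ i, (g (σ i) + if σ i = i₀ then 1 else 0) := by
      intro σ
      refine Finset.prod_congr rfl fun i _ => ?_
      simp only [w, g, m]
      split_ifs <;> simp_all
    have h2 : ∑ i, (g i + if i = i₀ then (1 : ℝ) else 0) = ∑ i, g i + 1 := by
      rw [Finset.sum_add_distrib]; simp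
    have h3 := Finset.prod_univ_sum (ι := Fin n) (fun _ => (Finset.univ : Finset ι))
      (fun _ i => g i + if i = i₀ then (1 : ℝ) else 0)
    rw [Fintype.piFinset_univ, Finset.prod_const, h2, Finset.card_univ, Fintype.card_fin] at h3
    rw [h3, Finset.sum_congr rfl fun σ _ => (h1 σ).symm]
  obtain ⟨τ, hτ, hτc⟩ := hsh n hn (range w)
    (by rw [hS]; convert sum_prod_le_sum_ite_mem_range m hm w hw)
  -- Pigeonhole over the types; r + 1 in place of r keeps the denominator positive.
  have hfib : ∃ l, c * n / (r + 1) ≤ (Finset.univ.filter fun i => τ i = some l).card := by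
    by_contra! hcon
    have h1 : (Finset.univ.filter fun i => τ i ≠ none).card ≤
        ∑ l, (Finset.univ.filter fun i => τ i = some l).card := by
      refine le_trans (Finset.card_le_card ?_) Finset.card_biUnion_le
      intro i hi
      obtain ⟨l, hl⟩ := Option.ne_none_iff_exists'.1 (Finset.mem_filter.1 hi).2
      exact Finset.mem_biUnion.2 ⟨l, Finset.mem_univ _, by simp [hl]⟩
    have h2 : ((∑ l, (Finset.univ.filter fun i => τ i = some l).card : ℕ) : ℝ) ≤
        r * (c * n / (r + 1)) := by
      push_cast
      calc _ ≤ ∑ _l : κ, c * n / (r + 1) := Finset.sum_le_sum fun l _ => (hcon l).le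
        _ = _ := by simp [hr]
    have h3 : r * (c * n / (r + 1)) < c * n := by
      have : (0 : ℝ) < c * n := by positivity
      rw [mul_div_assoc', div_lt_iff₀ (by positivity)]
      nlinarith
    have h4 : ((Finset.univ.filter fun i => τ i ≠ none).card : ℝ) ≤ _ := Nat.cast_le.2 h1
    have h5 : c * n ≤ ((Finset.univ.filter fun i => τ i ≠ none).card : ℝ) := by convert hτc
    linarith
  obtain ⟨l, hl⟩ := hfib
  refine ⟨l, Finset.univ.filter fun i => τ i = some l, by rwa [div_mul_eq_mul_div], fun ρ => ?_⟩
  obtain ⟨s, ⟨σ, rfl⟩, hs⟩ := hτ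
    (fun i => if ρ i = i₀ then Sum.inl ((τ i).getD l) else Sum.inr (ρ i)) (by
      intro i t hi
      simp only [hi, Option.getD_some]
      split_ifs with h1
      · exact mem_insert _ _
      · exact mem_insert_of_mem _ ⟨_, h1, rfl⟩)
  refine ⟨σ, fun i hi => ?_⟩
  have hi' := (Finset.mem_filter.1 hi).2
  have h1 := hs i l hi'
  simp only [w, hi', Option.getD_some] at h1
  split_ifs at h1 with h3 h4 h4
  · exact ⟨h3.trans h4.symm, fun _ => Sum.inl_injective h1⟩
  · exact ⟨Sum.inr_injective h1, fun h => absurd h h4⟩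

open scoped Classical in
/-- If one member of a tuple with positive independence density is covered by finitely many sets,
then it can be replaced by its intersection with one of them. -/
theorem PosIndep.exists_update {X ι κ : Type*} [Finite ι] [Finite κ] {T : X → X}
    {A : ι → Set X} (h : PosIndep T A) (i₀ : ι) (B : κ → Set X) (hB : A i₀ ⊆ ⋃ l, B l) :
    ∃ l, PosIndep T (Function.update A i₀ (A i₀ ∩ B l)) := by
  have hne := h.nonempty i₀
  obtain ⟨c₀, hc₀, h⟩ := h
  -- Outside `A i₀` the colour is arbitrary; a point of `A i₀` guarantees that one exists.
  have hp : ∀ y : X, ∃ l : κ, y ∈ A i₀ → y ∈ B l := by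
    intro y
    by_cases hy : y ∈ A i₀
    · exact (mem_iUnion.1 (hB hy)).imp fun _ hl _ => hl
    · exact (mem_iUnion.1 (hB hne.some_mem)).imp fun _ _ h => absurd h hy
  choose piece hpiece using hp
  obtain ⟨c, hc, hcol⟩ := exists_realize_words_of_coloring ι κ i₀
  suffices ∃ l, ∃ᶠ a : ℕ in atTop, ∃ E ⊆ Finset.range a,
      c * c₀ * a ≤ E.card ∧ IndepOn T (Function.update A i₀ (A i₀ ∩ B l)) E from
    this.imp fun l hl => ⟨c * c₀, by positivity, hl⟩
  refine ((h.and_eventually (eventually_gt_atTop 0)).mono ?_).exists_of_finite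
  rintro n ⟨⟨E, hEn, hcE, hE⟩, hn⟩
  have hEpos : 0 < E.card := by
    have : (0 : ℝ) < E.card := lt_of_lt_of_le (by positivity) hcE
    exact_mod_cast this
  let e : Fin E.card ≃ E := E.equivFin.symm
  have hx : ∀ σ : Fin E.card → ι, ∃ x, ∀ i, T^[(e i : ℕ)] x ∈ A (σ i) := by
    intro σ
    obtain ⟨x, hx⟩ := hE fun s => if hs : s ∈ E then σ (e.symm ⟨s, hs⟩) else i₀
    exact ⟨x, fun i => by simpa using hx (e i) (e i).2⟩
  choose x hx using hx
  obtain ⟨l, J, hJ, hJl⟩ := hcol E.card hEpos fun σ i => piece (T^[(e i : ℕ)] (x σ))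
  let emb : Fin E.card ↪ ℕ := e.toEmbedding.trans (Function.Embedding.subtype _)
  refine ⟨l, J.map emb, ?_, ?_, ?_⟩
  · intro s hs
    obtain ⟨i, -, rfl⟩ := Finset.mem_map.1 hs
    exact hEn (e i).2
  · rw [Finset.card_map]
    refine le_trans ?_ hJ
    rw [mul_assoc]
    gcongr
  · intro σ
    obtain ⟨ρ, hρ⟩ := hJl fun i => σ (emb i)
    refine ⟨x ρ, fun s hs' => ?_⟩
    obtain ⟨i, hi, rfl⟩ := Finset.mem_map.1 hs'
    obtain ⟨h1, h2⟩ := hρ i hi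
    have h3 := hx ρ i
    rw [h1] at h3
    change T^[(e i : ℕ)] (x ρ) ∈ _
    by_cases h4 : σ (emb i) = i₀
    · rw [h4] at h3 ⊢
      rw [Function.update_self]
      exact ⟨h3, h2 h4 ▸ hpiece _ h3⟩
    · rwa [Function.update_of_ne h4]

/-- Every member of a tuple with positive independence density can be replaced by its intersection
with some member of a given finite cover. -/
theorem PosIndep.exists_inter {X ι κ : Type*} [Finite ι] [Finite κ] {T : X → X}
    {A : ι → Set X} (h : PosIndep T A) (B : κ → Set X) (hB : ⋃ l, B l = univ) :
    ∃ f : ι → κ, PosIndep T (fun i => A i ∩ B (f i)) := by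
  classical
  cases nonempty_fintype ι
  suffices ∀ s : Finset ι, ∃ f : ι → κ, PosIndep T (fun i => if i ∈ s then A i ∩ B (f i) else A i) by
    simpa using this Finset.univ
  intro s
  induction s using Finset.induction_on with
  | empty =>
    have : ∀ i : ι, ∃ _ : κ, True := fun i => by
      obtain ⟨x, -⟩ := h.nonempty i
      exact ⟨(mem_iUnion.1 (hB ▸ mem_univ x)).choose, trivial⟩
    choose f _ using this
    exact ⟨f, by simpa using h⟩
  | insert a s ha ih =>
    obtain ⟨f, hf⟩ := ih
    obtain ⟨l, hl⟩ := hf.exists_update a B (by simp [hB])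
    refine ⟨Function.update f a l, hl.mono id fun i => ?_⟩
    by_cases hi : i = a
    · subst hi; simp [ha]
    · simp [hi]

/-- Passing to tuples of intersections `A i ∩ ⋂ⱼ T⁻ˢʲ A (g j)` along suitable late times `sⱼ`. -/
theorem PosIndep.exists_iInter_preimage {X ι κ : Type*} [Finite κ] {T : X → X}
    {A : ι → Set X} (h : PosIndep T A) (N : ℕ) :
    ∃ s : κ → ℕ, (∀ j, N ≤ s j) ∧
      PosIndep T (fun p : ι × (κ → ι) => A p.1 ∩ ⋂ j, T^[s j] ⁻¹' A (p.2 j)) := by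
  classical
  cases nonempty_fintype κ
  obtain ⟨c, hc, h⟩ := h
  -- At most N + 1 of the M offsets of a pattern lie in [t₀, t₀ + N], t₀ being the least, so one
  -- later offset remains for each element of κ. With L ≥ 4M/c, blocks of length L holding fewer
  -- than M points account for at most half of the c n points of E.
  set M : ℕ := N + 1 + Fintype.card κ with hM
  obtain ⟨L, hL⟩ := exists_nat_ge (4 * M / c)
  have hM0 : (0 : ℝ) < M := by positivity
  have hL0' : (0 : ℝ) < L := lt_of_lt_of_le (by positivity) hL
  have hL0 : 0 < L := by exact_mod_cast hL0'
  rw [div_le_iff₀ hc] at hL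
  -- Positively many blocks are rich, and one of the 2 ^ L possible patterns occurs in a fixed
  -- fraction of them. As there are finitely many patterns, R can then be taken the same for
  -- infinitely many n.
  have key : ∃ᶠ n : ℕ in atTop, ∃ R : Finset (Fin L), M ≤ R.card ∧ ∃ E ⊆ Finset.range n,
      IndepOn T A E ∧ ∃ G : Finset ℕ, c / (2 * L * 2 ^ L) * n ≤ G.card ∧
        ∀ b ∈ G, ∀ u ∈ R, b * L + u ∈ E := by
    refine (h.and_eventually (eventually_ge_atTop L)).mono ?_
    rintro n ⟨⟨E, hEn, hcE, hE⟩, hn⟩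
    have hn' : (L : ℝ) ≤ n := by exact_mod_cast hn
    let pat : ℕ → Finset (Fin L) := fun b => Finset.univ.filter fun u => b * L + u ∈ E
    let Q := n / L + 1
    let G := (Finset.range Q).filter fun b => M ≤ (pat b).card
    have hEcard : E.card ≤ ∑ b ∈ Finset.range Q, (pat b).card := by
      calc E.card ≤ ((Finset.range Q).biUnion fun b =>
            (pat b).image fun u : Fin L => b * L + (u : ℕ)).card := by
            refine Finset.card_le_card fun s hs => ?_
            have hsn := Finset.mem_range.1 (hEn hs)
            refine Finset.mem_biUnion.2 ⟨s / L, ?_, Finset.mem_image.2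
              ⟨⟨s % L, Nat.mod_lt _ hL0⟩, ?_, ?_⟩⟩
            · exact Finset.mem_range.2 (Nat.lt_succ_of_le (Nat.div_le_div_right hsn.le))
            · simp [pat, Nat.div_add_mod', hs]
            · simp [Nat.div_add_mod']
        _ ≤ _ := Finset.card_biUnion_le.trans
            (Finset.sum_le_sum fun b _ => Finset.card_image_le)
    have h1 : ∑ b ∈ Finset.range Q, (pat b).card ≤ L * G.card + M * Q := by
      calc _ ≤ ∑ b ∈ Finset.range Q, ((if M ≤ (pat b).card then L else 0) + M) := by
            refine Finset.sum_le_sum fun b _ => ?_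
            have : (pat b).card ≤ L := by simpa using Finset.card_le_univ (pat b)
            split_ifs <;> omega
        _ = _ := by
            rw [Finset.sum_add_distrib, ← Finset.sum_filter]
            simp [G, mul_comm]
    have hQ : (Q : ℝ) ≤ 2 * n / L := by
      have : ((n / L : ℕ) : ℝ) ≤ n / L := Nat.cast_div_le
      have h2 : (1 : ℝ) ≤ n / L := (one_le_div hL0').2 hn'
      simp only [Q]
      push_cast
      rw [mul_div_assoc]
      linarith
    have hG : c / (2 * L) * n ≤ G.card := by
      have h2 : (E.card : ℝ) ≤ L * G.card + M * Q := by exact_mod_cast hEcard.trans h1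
      have h3 : (M : ℝ) * Q ≤ c / 2 * n := by
        calc (M : ℝ) * Q ≤ M * (2 * n / L) := by gcongr
          _ = (4 * M) * n / (2 * L) := by field_simp; ring
          _ ≤ (L * c) * n / (2 * L) := by gcongr
          _ = c / 2 * n := by field_simp
      have h4 : c / 2 * n ≤ L * G.card := by linarith
      rw [div_mul_eq_mul_div, div_le_iff₀ (by positivity)]
      linarith
    have hfib : ∃ R ∈ (Finset.univ : Finset (Finset (Fin L))),
        c / (2 * L * 2 ^ L) * n ≤ (G.filter fun b => pat b = R).card := by
      by_contra! hcon
      have h2 : G.card = ∑ R : Finset (Fin L), (G.filter fun b => pat b = R).card :=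
        Finset.card_eq_sum_card_fiberwise fun b _ => Finset.mem_univ _
      have h3 : (G.card : ℝ) < ∑ _R : Finset (Fin L), c / (2 * L * 2 ^ L) * n := by
        rw [h2]; push_cast
        exact Finset.sum_lt_sum_of_nonempty Finset.univ_nonempty hcon
      have h4 : ∑ _R : Finset (Fin L), c / (2 * L * 2 ^ L) * n = c / (2 * L) * n := by
        simp; field_simp
      linarith
    obtain ⟨R, -, hR⟩ := hfib
    have hne : (G.filter fun b => pat b = R).Nonempty := by
      rw [← Finset.card_pos]
      have : (0 : ℝ) < n := lt_of_lt_of_le hL0' hn'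
      have : (0 : ℝ) < (G.filter fun b => pat b = R).card := lt_of_lt_of_le (by positivity) hR
      exact_mod_cast this
    refine ⟨R, ?_, E, hEn, hE, _, hR, ?_⟩
    · obtain ⟨b, hb⟩ := hne
      obtain ⟨hb, hbR⟩ := Finset.mem_filter.1 hb
      exact hbR ▸ (Finset.mem_filter.1 hb).2
    · intro b hb u hu
      obtain ⟨hb, rfl⟩ := Finset.mem_filter.1 hb
      exact (Finset.mem_filter.1 hu).2
  obtain ⟨R, hR⟩ := key.exists_of_finite
  have hRM : M ≤ R.card := hR.exists.choose_spec.1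
  have hRne : R.Nonempty := Finset.card_pos.1 (by omega)
  set t₀ := R.min' hRne with ht₀
  let R' := R.filter fun u : Fin L => (t₀ : ℕ) + N < u
  have hR' : Fintype.card κ ≤ Fintype.card R' := by
    have h1 : (R.filter fun u : Fin L => ¬ (t₀ : ℕ) + N < u).card ≤ N + 1 := by
      calc _ = ((R.filter fun u : Fin L => ¬ (t₀ : ℕ) + N < u).map Fin.valEmbedding).card := by simp
        _ ≤ (Finset.Icc (t₀ : ℕ) (t₀ + N)).card := by
          refine Finset.card_le_card fun v hv => ?_
          obtain ⟨u, hu, rfl⟩ := Finset.mem_map.1 hv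
          obtain ⟨hu, hu'⟩ := Finset.mem_filter.1 hu
          have : (t₀ : ℕ) ≤ u := R.min'_le u hu
          simp only [Fin.valEmbedding_apply, Finset.mem_Icc]
          omega
        _ = N + 1 := by simp; omega
    have h2 := R.card_filter_add_card_filter_not fun u : Fin L => (t₀ : ℕ) + N < u
    rw [Fintype.card_coe]
    change _ ≤ (R.filter fun u : Fin L => (t₀ : ℕ) + N < u).card
    omega
  obtain ⟨emb⟩ := Function.Embedding.nonempty_of_card_le hR'
  have hemb : ∀ j, (t₀ : ℕ) + N < (emb j : Fin L) := fun j =>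
    (Finset.mem_filter.1 (emb j).2).2
  have hembR : ∀ j, (emb j : Fin L) ∈ R := fun j => (Finset.mem_filter.1 (emb j).2).1
  refine ⟨fun j => (emb j : Fin L) - (t₀ : ℕ), fun j => by have := hemb j; dsimp only; omega,
    c / (2 * L * 2 ^ L), by positivity, hR.mono ?_⟩
  rintro n ⟨-, E, hEn, hE, G, hG, hGE⟩
  have hmod : ∀ (b : ℕ) (u : Fin L), (b * L + u) % L = u := fun b u => by
    rw [Nat.mul_comm, Nat.mul_add_mod, Nat.mod_eq_of_lt u.2]
  have hdiv : ∀ (b : ℕ) (u : Fin L), (b * L + u) / L = b := fun b u => by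
    rw [Nat.add_comm, Nat.add_mul_div_right _ _ hL0, Nat.div_eq_of_lt u.2, zero_add]
  refine ⟨G.image fun b => b * L + t₀, ?_, ?_, ?_⟩
  · intro s hs
    obtain ⟨b, hb, rfl⟩ := Finset.mem_image.1 hs
    exact hEn (hGE b hb _ (R.min'_mem hRne))
  · rwa [Finset.card_image_of_injective]
    intro b b' hbb
    simpa [hL0.ne'] using hbb
  · intro σ
    -- The symbol demanded at offset u of a block: i at t₀ and g j at the j-th chosen offset. These
    -- offsets are distinct, so the demands do not conflict.
    have hj : ∀ u : Fin L, ∃ f : (κ → ι) → ι → ι, (∀ g i, u = t₀ → f g i = i) ∧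
        ∀ j g i, u = (emb j : Fin L) → f g i = g j := by
      intro u
      by_cases hu : ∃ j, u = (emb j : Fin L)
      · obtain ⟨j, rfl⟩ := hu
        refine ⟨fun g _ => g j, fun g i h => ?_, fun j' g i h => ?_⟩
        · have := hemb j
          rw [h] at this
          omega
        · rw [emb.injective (Subtype.ext h)]
      · exact ⟨fun _ i => i, fun _ _ _ => rfl, fun j _ _ h => absurd ⟨j, h⟩ hu⟩
    choose f hf0 hfj using hj
    obtain ⟨x, hx⟩ := hE fun s => f ⟨s % L, Nat.mod_lt _ hL0⟩ (σ (s / L * L + t₀)).2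
      (σ (s / L * L + t₀)).1
    refine ⟨x, fun s hs => ?_⟩
    obtain ⟨b, hb, rfl⟩ := Finset.mem_image.1 hs
    refine ⟨?_, mem_iInter.2 fun j => ?_⟩
    · have := hx _ (hGE b hb _ (R.min'_mem hRne))
      simp only [← ht₀, hmod, hdiv, Fin.eta] at this
      rwa [hf0 _ _ _ rfl] at this
    · have := hx _ (hGE b hb _ (hembR j))
      simp only [hmod, hdiv, Fin.eta] at this
      rw [hfj _ j _ _ rfl] at this
      rw [mem_preimage, ← Function.iterate_add_apply]
      have hj := hemb j
      dsimp only
      convert this using 2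
      omega

/-! ### Windows of nearly maximal density -/

/-- Uniform upper bounds `(d + ε) (b - a) + K ε` for the number of points of `E` in windows. -/
def WindowBound (d : ℝ) (K : ℝ → ℝ) (E : Finset ℤ) : Prop :=
  ∀ ε > 0, ∀ a b : ℤ, a ≤ b → ((E ∩ Finset.Ico a b).card : ℝ) ≤ (d + ε) * (b - a) + K ε

theorem card_inter_Ico_le (E : Finset ℤ) (a b c : ℤ) :
    (E ∩ Finset.Ico a c).card ≤ (E ∩ Finset.Ico a b).card + (E ∩ Finset.Ico b c).card := by
  refine (Finset.card_le_card ?_).trans (Finset.card_union_le _ _)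
  intro s
  simp only [Finset.mem_inter, Finset.mem_union, Finset.mem_Ico]
  rintro ⟨h1, h2, h3⟩
  by_cases h : s < b
  · exact Or.inl ⟨h1, h2, h⟩
  · exact Or.inr ⟨h1, not_lt.1 h, h3⟩

open scoped Classical in
/-- The points of `[a, N)` from which some window of length at least `L` inside `[a, N)` has
density less than `d - ε`. -/
noncomputable def sparseStarts (d ε : ℝ) (L : ℕ) (N : ℤ) (E : Finset ℤ) (a : ℤ) : Finset ℤ :=
  (Finset.Ico a N).filter fun t => ∃ n : ℕ, L ≤ n ∧ 0 < n ∧ t + n ≤ N ∧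
    ((E ∩ Finset.Ico t (t + n)).card : ℝ) < (d - ε) * n

theorem mem_sparseStarts {d ε : ℝ} {L : ℕ} {N : ℤ} {E : Finset ℤ} {a t : ℤ} :
    t ∈ sparseStarts d ε L N E a ↔ (a ≤ t ∧ t < N) ∧ ∃ n : ℕ, L ≤ n ∧ 0 < n ∧ t + n ≤ N ∧
      ((E ∩ Finset.Ico t (t + n)).card : ℝ) < (d - ε) * n := by
  simp only [sparseStarts, Finset.mem_filter, Finset.mem_Ico]

/-- A maximal inequality for windows of low density. -/
theorem card_le_sub_card_sparseStarts {d ε ε' δ K : ℝ} (hε : 0 ≤ ε) (hε' : 0 ≤ ε') (hδ : 0 ≤ δ)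
    {L : ℕ} (hK : K ≤ δ * L) {E : Finset ℤ}
    (hE : ∀ a b : ℤ, a ≤ b → ((E ∩ Finset.Ico a b).card : ℝ) ≤ (d + ε') * (b - a) + K) (N : ℤ)
    (k : ℕ) : ∀ a : ℤ, a + k = N →
    ((E ∩ Finset.Ico a N).card : ℝ) ≤
      (d + ε' + δ) * (N - a) + K - ε * (sparseStarts d ε L N E a).card := by
  induction k using Nat.strong_induction_on with
  | _ k ih =>
  intro a hak
  by_cases hne : (sparseStarts d ε L N E a).Nonempty
  -- Greedy covering: skip the sparse window [b, b + n) at the leftmost sparse start, which saves ε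
  -- n and contains at most n sparse starts. The constant K incurred on [a, b) is absorbed by δ n
  -- because n ≥ L.
  · set b := (sparseStarts d ε L N E a).min' hne with hb
    have hbm := Finset.min'_mem _ hne
    rw [← hb] at hbm
    obtain ⟨hbI, n, hLn, hn, hbN, hlow⟩ := mem_sparseStarts.1 hbm
    have hIH := ih (N - (b + n)).toNat (by omega) (b + n) (by omega)
    have h1 := hE a b hbI.1
    have h2 := card_inter_Ico_le E a b N
    have h3 := card_inter_Ico_le E b (b + n) N
    have h4 : (sparseStarts d ε L N E a).card ≤ n + (sparseStarts d ε L N E (b + n)).card := by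
      calc _ ≤ (Finset.Ico b (b + n) ∪ sparseStarts d ε L N E (b + n)).card := by
            refine Finset.card_le_card fun t ht => ?_
            have hbt : b ≤ t := Finset.min'_le _ _ ht
            obtain ⟨h5, h6⟩ := mem_sparseStarts.1 ht
            by_cases htn : t < b + n
            · exact Finset.mem_union_left _ (Finset.mem_Ico.2 ⟨hbt, htn⟩)
            · exact Finset.mem_union_right _ (mem_sparseStarts.2
                ⟨⟨not_lt.1 htn, h5.2⟩, h6⟩)
        _ ≤ _ := (Finset.card_union_le _ _).trans (by simp)
    have h2' : ((E ∩ Finset.Ico a N).card : ℝ) ≤ (E ∩ Finset.Ico a b).card +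
      (E ∩ Finset.Ico b N).card := by exact_mod_cast h2
    have h3' : ((E ∩ Finset.Ico b N).card : ℝ) ≤ (E ∩ Finset.Ico b (b + n)).card +
      (E ∩ Finset.Ico (b + n) N).card := by exact_mod_cast h3
    have h4' : ε * ((sparseStarts d ε L N E a).card : ℝ) ≤
        ε * (n + (sparseStarts d ε L N E (b + n)).card) :=
      mul_le_mul_of_nonneg_left (by exact_mod_cast h4) hε
    have hKn : K ≤ δ * n := hK.trans (by gcongr)
    have hba : (0 : ℝ) ≤ b - a := by
      have : (a : ℝ) ≤ b := by exact_mod_cast hbI.1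
      linarith
    have h6 : 0 ≤ δ * (b - a) := mul_nonneg hδ hba
    have h7 : 0 ≤ ε' * n := by positivity
    push_cast at hIH
    nlinarith
  · rw [Finset.not_nonempty_iff_eq_empty] at hne
    have h1 := hE a N (by omega)
    have h2 : (0 : ℝ) ≤ δ * (N - a) := by
      have : (a : ℝ) ≤ N := by exact_mod_cast (by omega : a ≤ N)
      exact mul_nonneg hδ (by linarith)
    rw [hne]
    simp only [Finset.card_empty, Nat.cast_zero, mul_zero, sub_zero]
    linarith

/-- A set already attaining density d on [0, N) has almost no surplus elsewhere to make up for
sparse windows. The maximal inequality leaves ε times the number of sparse starts below ε η N / 2 +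
K, and large N absorbs K. -/
theorem exists_card_sparseStarts_le {d : ℝ} {K : ℝ → ℝ} {ε η : ℝ} (hε : 0 < ε) (hη : 0 < η) :
    ∃ L N₀ : ℕ, ∀ N : ℕ, N₀ ≤ N → ∀ E : Finset ℤ, WindowBound d K E →
      d * N ≤ (E ∩ Finset.Ico (0 : ℤ) N).card →
      ((sparseStarts d ε L N E 0).card : ℝ) ≤ η * N := by
  have hεη : 0 < ε * η / 4 := by positivity
  obtain ⟨L, hL⟩ := exists_nat_ge (K (ε * η / 4) / (ε * η / 4))
  obtain ⟨N₀, hN₀⟩ := exists_nat_ge (K (ε * η / 4) / (ε * η / 2))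
  refine ⟨L, N₀, fun N hN E hE hd => ?_⟩
  rw [div_le_iff₀ hεη] at hL
  rw [div_le_iff₀ (by positivity)] at hN₀
  have h1 := card_le_sub_card_sparseStarts (d := d) hε.le hεη.le hεη.le (L := L)
    (K := K (ε * η / 4)) (by linarith) (hE _ hεη) N N 0 (by simp)
  have h2 : (N₀ : ℝ) * (ε * η / 2) ≤ N * (ε * η / 2) := by gcongr
  have h3 : ε * (sparseStarts d ε L N E 0).card ≤ ε * (η * N) := by
    push_cast at h1
    nlinarith
  exact le_of_mul_le_mul_left h3 hε

theorem card_image_sub_inter_Ico (E : Finset ℤ) (c a b : ℤ) :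
    ((E.image fun s => c - s) ∩ Finset.Ico a b).card =
      (E ∩ Finset.Ico (c + 1 - b) (c + 1 - a)).card := by
  rw [← Finset.card_image_of_injective (E ∩ Finset.Ico (c + 1 - b) (c + 1 - a))
    (sub_right_injective (b := c))]
  congr 1
  ext s
  simp only [Finset.mem_inter, Finset.mem_image, Finset.mem_Ico]
  constructor
  · rintro ⟨⟨t, ht, rfl⟩, h1, h2⟩
    exact ⟨t, ⟨ht, by omega, by omega⟩, rfl⟩
  · rintro ⟨t, ⟨ht, h1, h2⟩, rfl⟩
    exact ⟨⟨t, ht, rfl⟩, by omega, by omega⟩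

theorem card_image_add_inter_Ico (E : Finset ℤ) (c a b : ℤ) :
    ((E.image fun s => s + c) ∩ Finset.Ico a b).card =
      (E ∩ Finset.Ico (a - c) (b - c)).card := by
  rw [← Finset.card_image_of_injective (E ∩ Finset.Ico (a - c) (b - c))
    (add_left_injective c)]
  congr 1
  ext s
  simp only [Finset.mem_inter, Finset.mem_image, Finset.mem_Ico]
  constructor
  · rintro ⟨⟨t, ht, rfl⟩, h1, h2⟩
    exact ⟨t, ⟨ht, by omega, by omega⟩, rfl⟩
  · rintro ⟨t, ⟨ht, h1, h2⟩, rfl⟩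
    exact ⟨⟨t, ht, rfl⟩, by omega, by omega⟩

theorem WindowBound.image_sub {d : ℝ} {K : ℝ → ℝ} {E : Finset ℤ} (h : WindowBound d K E) (c : ℤ) :
    WindowBound d K (E.image fun s => c - s) := by
  intro ε hε a b hab
  rw [card_image_sub_inter_Ico]
  refine (h ε hε _ _ (by omega)).trans (le_of_eq ?_)
  push_cast
  ring

/-- In a set of maximal density there are points from which all long windows to both sides have
nearly maximal density. -/
theorem exists_dense_center {d : ℝ} {K : ℝ → ℝ} :
    ∃ L : ℕ → ℕ, ∀ m : ℕ, ∃ N₀ : ℕ, ∀ N : ℕ, N₀ ≤ N → ∀ E : Finset ℤ, WindowBound d K E →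
      d * N ≤ (E ∩ Finset.Ico (0 : ℤ) N).card →
      ∃ t : ℤ, ∀ j ≤ m, ∀ n : ℕ, L j ≤ n → n ≤ m →
        (d - 1 / (j + 1)) * n ≤ (E ∩ Finset.Ico t (t + n)).card ∧
        (d - 1 / (j + 1)) * n ≤ (E ∩ Finset.Ico (t - n) t).card := by
  -- The fractions 2 ^ (-(j + 4)) add up, over all j and both directions, to at most 1/4. The
  -- lengths `L j` are fixed before m, which the later passage to the limit needs.
  have h1 : ∀ j : ℕ, ∃ L N₀ : ℕ, ∀ N : ℕ, N₀ ≤ N → ∀ E : Finset ℤ, WindowBound d K E →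
      d * N ≤ (E ∩ Finset.Ico (0 : ℤ) N).card →
      ((sparseStarts d (1 / (j + 1)) L N E 0).card : ℝ) ≤ (1 / 2) ^ (j + 4) * N := fun j =>
    exists_card_sparseStarts_le (by positivity) (by positivity)
  choose L N₁ h1 using h1
  refine ⟨L, fun m => ⟨∑ j ∈ Finset.range (m + 1), N₁ j + 8 * m + 8, fun N hN E hE hd => ?_⟩⟩
  have hN₁ : ∀ j ≤ m, N₁ j ≤ N := fun j hj => by
    have := Finset.single_le_sum (f := N₁) (fun i _ => Nat.zero_le _)
      (Finset.mem_range.2 (Nat.lt_succ_of_le hj))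
    rw [Nat.succ_eq_add_one] at this
    omega
  -- The reflection turns the window [t - n, t) into the window of length n starting at N - t.
  set E' := E.image fun s => (N - 1 : ℤ) - s with hE'def
  have hE' : WindowBound d K E' := hE.image_sub _
  have hd' : d * N ≤ (E' ∩ Finset.Ico (0 : ℤ) N).card := by
    rw [card_image_sub_inter_Ico]
    rwa [show (N - 1 + 1 - N : ℤ) = 0 by ring, show (N - 1 + 1 - 0 : ℤ) = N by ring]
  let B₁ : ℕ → Finset ℤ := fun j => sparseStarts d (1 / (j + 1)) (L j) N E 0
  let B₂ : ℕ → Finset ℤ := fun j => (sparseStarts d (1 / (j + 1)) (L j) N E' 0).image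
    fun t => (N : ℤ) - t
  let B := (Finset.range (m + 1)).biUnion fun j => B₁ j ∪ B₂ j
  have hB : (B.card : ℝ) ≤ 1 / 4 * N := by
    have h2 : B.card ≤ ∑ j ∈ Finset.range (m + 1), ((B₁ j).card + (B₂ j).card) :=
      Finset.card_biUnion_le.trans (Finset.sum_le_sum fun j _ => Finset.card_union_le _ _)
    have h3 : ∀ j ∈ Finset.range (m + 1), (((B₁ j).card : ℝ) + (B₂ j).card) ≤
        (1 / 2) ^ j * (1 / 8 * N) := by
      intro j hj
      have hj' := hN₁ j (Nat.lt_succ_iff.1 (Finset.mem_range.1 hj))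
      have h4 := h1 j N hj' E hE hd
      have h5 := h1 j N hj' E' hE' hd'
      have h6 : ((B₂ j).card : ℝ) ≤ (sparseStarts d (1 / (j + 1)) (L j) N E' 0).card := by
        exact Nat.cast_le.2 Finset.card_image_le
      rw [pow_add] at h4 h5
      simp only [B₁]
      linarith
    have h7 : (B.card : ℝ) ≤ ∑ j ∈ Finset.range (m + 1), (((B₁ j).card : ℝ) + (B₂ j).card) := by
      exact_mod_cast h2
    have h8 := h7.trans (Finset.sum_le_sum h3)
    rw [← Finset.sum_mul] at h8
    have h9 : ∑ j ∈ Finset.range (m + 1), (1 / 2 : ℝ) ^ j ≤ 2 := by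
      have := sum_geometric_two_le (m + 1)
      exact this
    have h10 : (∑ j ∈ Finset.range (m + 1), (1 / 2 : ℝ) ^ j) * (1 / 8 * N) ≤ 2 * (1 / 8 * N) := by
      gcongr
    linarith
  obtain ⟨t, ht, htB⟩ : ∃ t ∈ Finset.Ico (m : ℤ) (N - m), t ∉ B := by
    by_contra! hcon
    have h2 : (Finset.Ico (m : ℤ) (N - m)).card ≤ B.card := Finset.card_le_card hcon
    have h3 : N ≤ (Finset.Ico (m : ℤ) (N - m)).card + 2 * m := by
      rw [Int.card_Ico]; omega
    have h4 : (N : ℝ) ≤ B.card + 2 * m := by exact_mod_cast (by omega : N ≤ B.card + 2 * m)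
    have h5 : (8 * m + 8 : ℝ) ≤ N := by exact_mod_cast (by omega : 8 * m + 8 ≤ N)
    linarith
  rw [Finset.mem_Ico] at ht
  refine ⟨t, fun j hj n hLn hnm => ?_⟩
  rcases Nat.eq_zero_or_pos n with rfl | hn
  · simp
  have htj : t ∉ B₁ j ∪ B₂ j := fun h =>
    htB (Finset.mem_biUnion.2 ⟨j, Finset.mem_range.2 (Nat.lt_succ_of_le hj), h⟩)
  rw [Finset.mem_union, not_or] at htj
  constructor
  · by_contra! hlt
    exact htj.1 (mem_sparseStarts.2
      ⟨⟨by omega, by omega⟩, n, hLn, hn, by omega, hlt⟩)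
  · by_contra! hlt
    refine htj.2 (Finset.mem_image.2 ⟨N - t, mem_sparseStarts.2
      ⟨⟨by omega, by omega⟩, n, hLn, hn, by omega, ?_⟩, by omega⟩)
    rw [card_image_sub_inter_Ico]
    rwa [show (N - 1 + 1 - (N - t + n) : ℤ) = t - n by ring,
      show (N - 1 + 1 - (N - t) : ℤ) = t by ring]

/-! ### Exact densities from hereditary families -/

open scoped Classical in
/-- The largest cardinality of a member of `Fam` inside `[0, n)`. -/
noncomputable def maxCard (Fam : Set (Finset ℤ)) (n : ℕ) : ℕ :=
  ((Finset.Ico (0 : ℤ) n).powerset.filter (· ∈ Fam)).sup Finset.card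

section
variable {Fam : Set (Finset ℤ)}

theorem card_le_maxCard (hshift : ∀ E ∈ Fam, ∀ t : ℤ, (E.image fun s => s + t) ∈ Fam)
    {E : Finset ℤ} (hE : E ∈ Fam) {a : ℤ} {n : ℕ} (h : E ⊆ Finset.Ico a (a + n)) :
    E.card ≤ maxCard Fam n := by
  classical
  rw [← Finset.card_image_of_injective E (add_left_injective (-a))]
  refine Finset.le_sup (f := Finset.card) (Finset.mem_filter.2 ⟨Finset.mem_powerset.2 ?_,
    hshift E hE _⟩)
  intro s hs
  obtain ⟨u, hu, rfl⟩ := Finset.mem_image.1 hs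
  have := Finset.mem_Ico.1 (h hu)
  exact Finset.mem_Ico.2 ⟨by omega, by omega⟩

theorem exists_card_eq_maxCard (hne : ∅ ∈ Fam) (n : ℕ) :
    ∃ E ∈ Fam, E ⊆ Finset.Ico (0 : ℤ) n ∧ E.card = maxCard Fam n := by
  classical
  obtain ⟨E, hE, h⟩ := Finset.exists_mem_eq_sup
    ((Finset.Ico (0 : ℤ) n).powerset.filter (· ∈ Fam)) ⟨∅, by simp [hne]⟩ Finset.card
  rw [Finset.mem_filter, Finset.mem_powerset] at hE
  exact ⟨E, hE.2, hE.1, by rw [← h, maxCard]⟩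

theorem subadditive_maxCard (hne : ∅ ∈ Fam) (hsub : ∀ E ∈ Fam, ∀ F ⊆ E, F ∈ Fam)
    (hshift : ∀ E ∈ Fam, ∀ t : ℤ, (E.image fun s => s + t) ∈ Fam) :
    Subadditive fun n => (maxCard Fam n : ℝ) := by
  intro m n
  obtain ⟨E, hE, hEs, hEc⟩ := exists_card_eq_maxCard hne (m + n)
  have h1 := card_inter_Ico_le E 0 m (m + n : ℕ)
  rw [Finset.inter_eq_left.2 hEs, hEc] at h1
  have h2 : (E ∩ Finset.Ico (0 : ℤ) m).card ≤ maxCard Fam m :=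
    card_le_maxCard hshift (hsub E hE _ Finset.inter_subset_left) (a := 0)
      (by simp)
  have h3 : (E ∩ Finset.Ico (m : ℤ) (m + n : ℕ)).card ≤ maxCard Fam n :=
    card_le_maxCard hshift (hsub E hE _ Finset.inter_subset_left) (a := m)
      (by push_cast; exact Finset.inter_subset_right)
  have h4 := h1.trans (add_le_add h2 h3)
  dsimp only
  exact_mod_cast h4

/-- The maximal density `d` of members of `Fam`, with the resulting uniform window bounds. -/
theorem exists_windowBound (hne : ∅ ∈ Fam) (hsub : ∀ E ∈ Fam, ∀ F ⊆ E, F ∈ Fam)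
    (hshift : ∀ E ∈ Fam, ∀ t : ℤ, (E.image fun s => s + t) ∈ Fam) {c : ℝ} (hc : 0 < c)
    (h : ∃ᶠ n : ℕ in atTop, c * n ≤ maxCard Fam n) :
    ∃ d : ℝ, 0 < d ∧ (∀ n : ℕ, d * n ≤ maxCard Fam n) ∧
      ∃ K : ℝ → ℝ, ∀ E ∈ Fam, WindowBound d K E := by
  -- Fekete's lemma: d is both the infimum and the limit of `maxCard Fam n / n`. The infimum gives
  -- the lower bound for every n, the limit the upper bound, with `K ε` covering the finitely many
  -- exceptions.
  have hs := subadditive_maxCard hne hsub hshift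
  have hbdd : BddBelow (range fun n : ℕ => (maxCard Fam n : ℝ) / n) :=
    ⟨0, by rintro _ ⟨n, rfl⟩; positivity⟩
  have hlim := hs.tendsto_lim hbdd
  have hcl : c ≤ hs.lim := by
    refine ge_of_tendsto_of_frequently hlim ((h.and_eventually (eventually_gt_atTop 0)).mono ?_)
    rintro n ⟨h, hn⟩
    exact (le_div_iff₀ (by exact_mod_cast hn)).2 h
  have hK : ∀ ε : ℝ, ∃ K : ℝ, 0 < ε → ∀ n : ℕ, (maxCard Fam n : ℝ) ≤ (hs.lim + ε) * n + K := by
    intro ε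
    by_cases hε : 0 < ε
    · obtain ⟨N, hN⟩ := eventually_atTop.1
        (hlim.eventually (gt_mem_nhds (lt_add_of_pos_right hs.lim hε)))
      refine ⟨N + ∑ n ∈ Finset.range (N + 1), (maxCard Fam n : ℝ), fun _ n => ?_⟩
      have hnn : ∀ i ∈ Finset.range (N + 1), (0 : ℝ) ≤ (maxCard Fam i : ℝ) :=
        fun i _ => Nat.cast_nonneg _
      have h0 : 0 ≤ (hs.lim + ε) * n := by
        have := hc.trans_le hcl
        positivity
      by_cases hn : n ≤ N
      · have := Finset.single_le_sum hnn (Finset.mem_range.2 (Nat.lt_succ_of_le hn))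
        have h2 : (0 : ℝ) ≤ N := Nat.cast_nonneg _
        linarith
      · have h1 := hN n (by omega)
        rw [div_lt_iff₀ (by exact_mod_cast (by omega : 0 < n))] at h1
        have h2 := Finset.sum_nonneg hnn
        have h3 : (0 : ℝ) ≤ N := Nat.cast_nonneg _
        linarith
    · exact ⟨0, fun h => absurd h hε⟩
  choose K hK using hK
  refine ⟨hs.lim, hc.trans_le hcl, fun n => ?_, K, fun E hE ε hε a b hab => ?_⟩
  · rcases Nat.eq_zero_or_pos n with rfl | hn
    · simp
    · exact (le_div_iff₀ (by exact_mod_cast hn)).1 (hs.lim_le_div hbdd hn.ne')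
  · obtain ⟨n, hn⟩ := Int.le.dest hab
    have h1 : (E ∩ Finset.Ico a b).card ≤ maxCard Fam n :=
      card_le_maxCard hshift (hsub E hE _ Finset.inter_subset_left) (a := a)
        (by rw [hn]; exact Finset.inter_subset_right)
    have h2 : (b : ℝ) - a = n := by rw [← hn]; push_cast; ring
    rw [h2]
    exact le_trans (by exact_mod_cast h1) (hK ε hε n)

end

/-- A pointwise limit of finite sets of integers along an ultrafilter agrees with members of the
sequence on every finite window. -/
theorem exists_ultralimit (E : ℕ → Finset ℤ) :
    ∃ J : Set ℤ, ∀ F : Finset ℤ, ∃ᶠ m in atTop, ∀ s ∈ F, (s ∈ E m ↔ s ∈ J) := by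
  refine ⟨{s | ∀ᶠ m in (hyperfilter ℕ : Filter ℕ), s ∈ E m}, fun F => ?_⟩
  have h : ∀ᶠ m in (hyperfilter ℕ : Filter ℕ), ∀ s ∈ F,
      (s ∈ E m ↔ s ∈ {s | ∀ᶠ m in (hyperfilter ℕ : Filter ℕ), s ∈ E m}) := by
    rw [Finset.eventually_all]
    intro s _
    by_cases hs : ∀ᶠ m in (hyperfilter ℕ : Filter ℕ), s ∈ E m
    · exact hs.mono fun m hm => ⟨fun _ => hs, fun _ => hm⟩
    · exact (Ultrafilter.eventually_not.2 hs).mono fun m hm => ⟨fun h => absurd h hm,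
        fun h => absurd h hs⟩
  have h2 := h.frequently
  exact h2.filter_mono (by rw [← Nat.cofinite_eq_atTop]; exact hyperfilter_le_cofinite)

/-- A translation invariant hereditary family of finite sets of integers with members of density
bounded below admits a set of integers that has a positive density to both sides and all of whose
finite subsets belong to the family. -/
theorem exists_density_of_hereditary {Fam : Set (Finset ℤ)} (hne : ∅ ∈ Fam)
    (hsub : ∀ E ∈ Fam, ∀ F ⊆ E, F ∈ Fam)
    (hshift : ∀ E ∈ Fam, ∀ t : ℤ, (E.image fun s => s + t) ∈ Fam) {c : ℝ} (hc : 0 < c)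
    (h : ∃ᶠ n : ℕ in atTop, c * n ≤ maxCard Fam n) :
    ∃ d : ℝ, 0 < d ∧ ∃ J : Set ℤ, (∀ E : Finset ℤ, (E : Set ℤ) ⊆ J → E ∈ Fam) ∧
      Tendsto (fun n : ℕ => ((J ∩ Set.Ico 0 (n : ℤ)).ncard : ℝ) / n) atTop (𝓝 d) ∧
      Tendsto (fun n : ℕ => ((J ∩ Set.Ico (-(n : ℤ)) 0).ncard : ℝ) / n) atTop (𝓝 d) := by
  obtain ⟨d, hd, hdn, K, hK⟩ := exists_windowBound hne hsub hshift hc h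
  obtain ⟨L, hL⟩ := exists_dense_center (d := d) (K := K)
  -- Extremal sets, translated so that a dense centre sits at 0. Each lower bound concerns a fixed
  -- window and a threshold `L j` independent of m, so it survives in the limit J.
  have hE : ∀ m : ℕ, ∃ E ∈ Fam, ∀ j ≤ m, ∀ n : ℕ, L j ≤ n → n ≤ m →
        (d - 1 / (j + 1)) * n ≤ (E ∩ Finset.Ico (0 : ℤ) n).card ∧
        (d - 1 / (j + 1)) * n ≤ (E ∩ Finset.Ico (-(n : ℤ)) 0).card := by
    intro m
    obtain ⟨N, hN⟩ := hL m
    obtain ⟨E, hE, hEs, hEc⟩ := exists_card_eq_maxCard hne N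
    obtain ⟨t, ht⟩ := hN N le_rfl E (hK E hE) (by
      rw [Finset.inter_eq_left.2 hEs, hEc]; exact hdn N)
    refine ⟨_, hshift E hE (-t), fun j hj n hLn hnm => ?_⟩
    have := ht j hj n hLn hnm
    rw [card_image_add_inter_Ico, card_image_add_inter_Ico]
    simpa [add_comm, sub_eq_add_neg] using this
  choose E hEF hE using hE
  obtain ⟨J, hJ⟩ := exists_ultralimit E
  have hcard : ∀ a b : ℤ, ∃ᶠ m in atTop,
      (J ∩ Set.Ico a b).ncard = (E m ∩ Finset.Ico a b).card := by
    intro a b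
    refine (hJ (Finset.Ico a b)).mono fun m hm => ?_
    rw [← Set.ncard_coe_finset]
    congr 1
    ext s
    simp only [Set.mem_inter_iff, Set.mem_Ico, Finset.coe_inter, Finset.coe_Ico, Finset.mem_coe]
    constructor
    · rintro ⟨h1, h2⟩
      exact ⟨(hm s (Finset.mem_Ico.2 h2)).2 h1, h2⟩
    · rintro ⟨h1, h2⟩
      exact ⟨(hm s (Finset.mem_Ico.2 h2)).1 h1, h2⟩
  have hupper : ∀ a b : ℤ, a ≤ b → ∀ ε > 0,
      ((J ∩ Set.Ico a b).ncard : ℝ) ≤ (d + ε) * (b - a) + K ε := by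
    intro a b hab ε hε
    obtain ⟨m, hm⟩ := (hcard a b).exists
    rw [hm]
    exact hK _ (hEF m) ε hε a b hab
  have hlim : ∀ u : ℕ → ℕ, (∀ ε > 0, ∀ n : ℕ, (u n : ℝ) ≤ (d + ε) * n + K ε) →
      (∀ j n : ℕ, L j ≤ n → (d - 1 / (j + 1)) * n ≤ u n) →
      Tendsto (fun n : ℕ => (u n : ℝ) / n) atTop (𝓝 d) := by
    intro u hu1 hu2
    rw [tendsto_order]
    constructor
    · intro a ha
      obtain ⟨j, hj⟩ := exists_nat_one_div_lt (sub_pos.2 ha)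
      filter_upwards [eventually_ge_atTop (L j), eventually_gt_atTop 0] with n hn hn0
      have hn0' : (0 : ℝ) < n := by exact_mod_cast hn0
      rw [lt_div_iff₀ hn0']
      refine lt_of_lt_of_le ?_ (hu2 j n hn)
      gcongr
      linarith
    · intro a ha
      have hε : 0 < (a - d) / 2 := by linarith
      have h1 : ∀ᶠ n : ℕ in atTop, K ((a - d) / 2) / ((a - d) / 2) < n :=
        tendsto_natCast_atTop_atTop.eventually (eventually_gt_atTop _)
      filter_upwards [h1, eventually_gt_atTop 0] with n hn hn0
      have hn0' : (0 : ℝ) < n := by exact_mod_cast hn0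
      rw [div_lt_iff₀ hn0']
      rw [div_lt_iff₀ hε] at hn
      have := hu1 _ hε n
      nlinarith
  refine ⟨d, hd, J, fun F hF => ?_, hlim _ ?_ ?_, hlim _ ?_ ?_⟩
  · obtain ⟨m, hm⟩ := (hJ F).exists
    exact hsub _ (hEF m) F fun s hs => (hm s hs).2 (hF hs)
  · intro ε hε n
    simpa using hupper 0 n (by omega) ε hε
  · intro j n hn
    obtain ⟨m, hm, hm'⟩ := ((hcard 0 n).and_eventually (eventually_ge_atTop (max j n))).exists
    rw [hm]
    exact (hE m j (le_of_max_le_left hm') n hn (le_of_max_le_right hm')).1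
  · intro ε hε n
    simpa using hupper (-n) 0 (by omega) ε hε
  · intro j n hn
    obtain ⟨m, hm, hm'⟩ := ((hcard (-n) 0).and_eventually (eventually_ge_atTop (max j n))).exists
    rw [hm]
    exact (hE m j (le_of_max_le_left hm') n hn (le_of_max_le_right hm')).2

/-! ### Equivalence of finite and infinite independence -/

section
variable {X ι : Type*}

/-- The finite sets of integers that have a translate that is an independence set. -/
def indepFamily (T : X → X) (A : ι → Set X) : Set (Finset ℤ) :=
  {E | ∃ t : ℤ, ∀ σ : ℤ → ι, ∃ x, ∀ s ∈ E, 0 ≤ s + t ∧ T^[(s + t).toNat] x ∈ A (σ s)}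

/-- A tuple with positive independence density has a two-sided independence set of exact
density. -/
theorem PosIndep.exists_density {T : X → X} {A : ι → Set X} [Nonempty X]
    (h : PosIndep T A) :
    ∃ d : ℝ, 0 < d ∧ ∃ J : Set ℤ, (∀ E : Finset ℤ, (E : Set ℤ) ⊆ J → E ∈ indepFamily T A) ∧
      Tendsto (fun n : ℕ => ((J ∩ Set.Ico 0 (n : ℤ)).ncard : ℝ) / n) atTop (𝓝 d) ∧
      Tendsto (fun n : ℕ => ((J ∩ Set.Ico (-(n : ℤ)) 0).ncard : ℝ) / n) atTop (𝓝 d) := by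
  have hsub : ∀ E ∈ indepFamily T A, ∀ F ⊆ E, F ∈ indepFamily T A := by
    rintro E ⟨t, ht⟩ F hF
    exact ⟨t, fun σ => (ht σ).imp fun x hx s hs => hx s (hF hs)⟩
  have hshift : ∀ E ∈ indepFamily T A, ∀ u : ℤ, (E.image fun s => s + u) ∈ indepFamily T A := by
    rintro E ⟨t, ht⟩ u
    refine ⟨t - u, fun σ => ?_⟩
    obtain ⟨x, hx⟩ := ht fun s => σ (s + u)
    refine ⟨x, fun s hs => ?_⟩
    obtain ⟨v, hv, rfl⟩ := Finset.mem_image.1 hs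
    rw [add_add_sub_cancel]
    exact hx v hv
  obtain ⟨c, hc, h⟩ := h
  refine exists_density_of_hereditary ⟨0, fun σ => ⟨Classical.arbitrary X, by simp⟩⟩ hsub hshift hc
    (h.mono ?_)
  rintro n ⟨E, hEn, hcE, hE⟩
  refine hcE.trans (Nat.cast_le.2 ?_)
  rw [← Finset.card_image_of_injective E Nat.cast_injective (α := ℕ) (β := ℤ)]
  refine card_le_maxCard (a := 0) hshift ⟨0, fun σ => ?_⟩ ?_
  · obtain ⟨x, hx⟩ := hE fun s => σ s
    refine ⟨x, fun s hs => ?_⟩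
    obtain ⟨v, hv, rfl⟩ := Finset.mem_image.1 hs
    simpa using hx v hv
  · intro s hs
    obtain ⟨v, hv, rfl⟩ := Finset.mem_image.1 hs
    have := Finset.mem_range.1 (hEn hv)
    exact Finset.mem_Ico.2 ⟨by omega, by omega⟩

theorem IsIndependenceSet.exists_mem {G : Type*} {act : G → X → X} {k : ℕ} {A : Fin k → Set X}
    {J : Set G} (h : IsIndependenceSet act A J) (I : Finset G) (hI : I.Nonempty)
    (hIJ : (I : Set G) ⊆ J) (σ : G → Fin k) : ∃ x, ∀ s ∈ I, act s x ∈ A (σ s) := by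
  obtain ⟨x, hx⟩ := h I hI hIJ fun s => σ s
  exact ⟨x, fun s hs => mem_iInter.1 hx ⟨s, hs⟩⟩

theorem isIndependenceSet_of_forall {G : Type*} {act : G → X → X} {k : ℕ} {A : Fin k → Set X}
    {J : Set G} (h : ∀ I : Finset G, (I : Set G) ⊆ J → ∀ σ : G → Fin k,
      ∃ x, ∀ s ∈ I, act s x ∈ A (σ s)) : IsIndependenceSet act A J := by
  classical
  intro I hI hIJ σ
  obtain ⟨s₀, hs₀⟩ := hI
  obtain ⟨x, hx⟩ := h I hIJ fun s => if hs : s ∈ I then σ ⟨s, hs⟩ else σ ⟨s₀, hs₀⟩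
  exact ⟨x, mem_iInter.2 fun s => by simpa using hx s s.2⟩

/-- The translation is undone by moving the witness: forward along its orbit if t ≥ 0, and to an
iterated preimage if t < 0, where surjectivity enters. -/
theorem indepOn_of_image_mem_indepFamily {T : X → X} (hT : Function.Surjective T) {A : ι → Set X}
    {E : Finset ℕ} (h : E.image (fun n : ℕ => (n : ℤ)) ∈ indepFamily T A) : IndepOn T A E := by
  obtain ⟨t, ht⟩ := h
  intro σ
  obtain ⟨x, hx⟩ := ht fun s => σ s.toNat
  have hx' : ∀ s ∈ E, 0 ≤ (s : ℤ) + t ∧ T^[((s : ℤ) + t).toNat] x ∈ A (σ s) := fun s hs => by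
    simpa using hx s (Finset.mem_image_of_mem _ hs)
  rcases le_total 0 t with h0 | h0
  · lift t to ℕ using h0
    refine ⟨T^[t] x, fun s hs => ?_⟩
    rw [← Function.iterate_add_apply]
    exact (hx' s hs).2
  · obtain ⟨u, rfl⟩ := Int.exists_eq_neg_ofNat h0
    obtain ⟨y, rfl⟩ := hT.iterate u x
    refine ⟨y, fun s hs => ?_⟩
    obtain ⟨h1, h2⟩ := hx' s hs
    rw [← Function.iterate_add_apply] at h2
    convert h2 using 2
    omega

end

theorem DynSys.continuous_map {X : Type*} [TopologicalSpace X] : ∀ S : DynSys X, Continuous S.map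
  | .nat _ h _ => h
  | .int T => T.continuous

theorem PosIndep.hasPosDensityIndependenceSet {X : Type*} [TopologicalSpace X] {k : ℕ}
    (hk : 0 < k) {A : Fin k → Set X} (S : DynSys X) (h : PosIndep S.map A) :
    S.HasPosDensityIndependenceSet A := by
  have : Nonempty X := ⟨(h.nonempty ⟨0, hk⟩).some⟩
  obtain ⟨d, hd, J, hJ, hr, hl⟩ := h.exists_density
  -- The interval {0, …, n} has n + 1 points, hence the shift of the index.
  have hr' := hr.comp (tendsto_add_atTop_nat 1)
  cases S with
  | nat T hc hs =>
    refine ⟨{n | (n : ℤ) ∈ J}, ⟨d, hd.ne', ?_⟩, isIndependenceSet_of_forall fun I hI σ => ?_⟩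
    · refine hr'.congr fun n => ?_
      simp only [Function.comp, Nat.cast_add, Nat.cast_one]
      congr 2
      rw [← Set.ncard_image_of_injective _ (Nat.cast_injective (R := ℤ))]
      congr 1
      ext s
      simp only [mem_inter_iff, mem_Ico, mem_image, mem_ofPred_eq, mem_Icc]
      constructor
      · rintro ⟨h1, h2, h3⟩
        lift s to ℕ using h2
        exact ⟨s, ⟨h1, by omega, by omega⟩, rfl⟩
      · rintro ⟨u, ⟨h1, h2, h3⟩, rfl⟩
        exact ⟨h1, by omega, by omega⟩
    · refine indepOn_of_image_mem_indepFamily hs (hJ _ ?_) σ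
      intro s hs
      obtain ⟨u, hu, rfl⟩ := Finset.mem_image.1 (Finset.mem_coe.1 hs)
      exact hI hu
  | int T =>
    refine ⟨J, ⟨d, hd.ne', ?_⟩, isIndependenceSet_of_forall fun I hI σ => ?_⟩
    -- The density on {-n, …, n} is the average of the right and left densities with weights (n +
    -- 1)/(2n + 1) and n/(2n + 1).
    · have h1 : Tendsto (fun n : ℕ => (n : ℝ) / (2 * n + 1)) atTop (𝓝 (1 / 2)) := by
        have h2 : Tendsto (fun n : ℕ => 1 / 2 - 1 / 2 * (1 / (2 * (n : ℝ) + 1))) atTop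
            (𝓝 (1 / 2 - 1 / 2 * 0)) := by
          refine tendsto_const_nhds.sub (tendsto_const_nhds.mul ?_)
          refine tendsto_const_nhds.div_atTop (tendsto_atTop_add_const_right _ _ ?_)
          exact tendsto_natCast_atTop_atTop.const_mul_atTop two_pos
        rw [mul_zero, sub_zero] at h2
        refine h2.congr fun n => ?_
        field_simp
        ring
      have h3 : Tendsto (fun n : ℕ => ((n : ℝ) + 1) / (2 * n + 1)) atTop (𝓝 (1 - 1 / 2)) := by
        refine (tendsto_const_nhds.sub h1).congr fun n => ?_
        field_simp
        ring
      have h4 := (hr'.mul h3).add (hl.mul h1)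
      rw [show d * (1 - 1 / 2) + d * (1 / 2) = d by ring] at h4
      refine h4.congr' ?_
      filter_upwards [eventually_gt_atTop 0] with n hn
      have hn' : (n : ℝ) ≠ 0 := by exact_mod_cast hn.ne'
      have h5 : (J ∩ Set.Icc (-(n : ℤ)) n).ncard =
          (J ∩ Set.Ico 0 ((n + 1 : ℕ) : ℤ)).ncard + (J ∩ Set.Ico (-(n : ℤ)) 0).ncard := by
        rw [← Set.ncard_union_eq]
        · congr 1
          ext s
          simp only [mem_inter_iff, mem_Ico, mem_Icc, mem_union]
          by_cases hs : s ∈ J <;> simp only [hs, true_and, false_and, or_self]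
          omega
        · rw [Set.disjoint_left]
          rintro s ⟨-, h1⟩ ⟨-, h2⟩
          exact absurd h1.1 (not_le.2 h2.2)
      simp only [Function.comp]
      rw [h5]
      push_cast
      have h6 : (n : ℝ) + 1 ≠ 0 := by positivity
      have h7 : (2 * n : ℝ) + 1 ≠ 0 := by positivity
      field_simp
    · obtain ⟨t, ht⟩ := hJ I hI
      obtain ⟨x, hx⟩ := ht σ
      refine ⟨(T.toEquiv ^ t : Equiv.Perm X) x, fun s hs => ?_⟩
      obtain ⟨h1, h2⟩ := hx s hs
      rw [← Equiv.Perm.mul_apply, ← zpow_add]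
      obtain ⟨u, hu⟩ := Int.eq_ofNat_of_zero_le h1
      rw [hu] at h2 ⊢
      rw [zpow_natCast, ← Equiv.Perm.iterate_eq_pow]
      exact h2

/-- A nonzero limit of nonnegative quotients is positive, so long windows keep at least half the
density. For ℤ the window {-n, …, n} is moved to {0, …, 2n}, and the witness by T ^ (-n). -/
theorem DynSys.HasPosDensityIndependenceSet.posIndep {X : Type*} [TopologicalSpace X] {k : ℕ}
    {A : Fin k → Set X} {S : DynSys X} (h : S.HasPosDensityIndependenceSet A) :
    PosIndep S.map A := by
  classical
  have hpos : ∀ {u : ℕ → ℝ} {d : ℝ}, (∀ n, 0 ≤ u n) → d ≠ 0 → Tendsto u atTop (𝓝 d) →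
      0 < d ∧ ∀ᶠ n in atTop, d / 2 < u n := by
    intro u d hu hd hlim
    have h0 : 0 < d := lt_of_le_of_ne (ge_of_tendsto' hlim hu) hd.symm
    exact ⟨h0, hlim.eventually (lt_mem_nhds (half_lt_self h0))⟩
  cases S with
  | nat T hc hs =>
    obtain ⟨J, ⟨d, hd, hlim⟩, hJ⟩ := h
    obtain ⟨hd0, hev⟩ := hpos (fun n => by positivity) hd hlim
    refine ⟨d / 2, by positivity, frequently_atTop.2 fun a => ?_⟩
    obtain ⟨n, hn, hna⟩ := (hev.and (eventually_ge_atTop a)).exists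
    have hcard : (J ∩ Set.Icc 0 n).ncard = ((Finset.range (n + 1)).filter (· ∈ J)).card := by
      rw [← Set.ncard_coe_finset]
      congr 1
      ext s
      simp only [mem_inter_iff, mem_Icc, Finset.coe_filter, Finset.mem_range, mem_ofPred_eq]
      exact ⟨fun h => ⟨by omega, h.1⟩, fun h => ⟨h.2, by omega, by omega⟩⟩
    rw [hcard, lt_div_iff₀ (by positivity)] at hn
    have hne : ((Finset.range (n + 1)).filter (· ∈ J)).Nonempty := by
      rw [← Finset.card_pos]
      have : (0 : ℝ) < ((Finset.range (n + 1)).filter (· ∈ J)).card := lt_trans (by positivity) hn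
      exact_mod_cast this
    refine ⟨n + 1, by omega, _, Finset.filter_subset _ _, by push_cast; exact hn.le, fun σ => ?_⟩
    exact hJ.exists_mem _ hne (fun s hs => (Finset.mem_filter.1 (Finset.mem_coe.1 hs)).2) σ
  | int T =>
    obtain ⟨J, ⟨d, hd, hlim⟩, hJ⟩ := h
    obtain ⟨hd0, hev⟩ := hpos (fun n => by positivity) hd hlim
    refine ⟨d / 2, by positivity, frequently_atTop.2 fun a => ?_⟩
    obtain ⟨n, hn, hna⟩ := (hev.and (eventually_ge_atTop a)).exists
    set E := (Finset.range (2 * n + 1)).filter fun s : ℕ => (s : ℤ) - n ∈ J with hE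
    have hinj : Function.Injective fun s : ℕ => (s : ℤ) - n := fun s s' h => by
      simp only at h; omega
    have hcard : (J ∩ Set.Icc (-(n : ℤ)) n).ncard = E.card := by
      rw [← Finset.card_image_of_injective E hinj, ← Set.ncard_coe_finset]
      congr 1
      ext s
      simp only [mem_inter_iff, mem_Icc, Finset.coe_image, mem_image, Finset.mem_coe, hE,
        Finset.mem_filter, Finset.mem_range]
      constructor
      · rintro ⟨h1, h2, h3⟩
        refine ⟨(s + n).toNat, ⟨by omega, ?_⟩, by omega⟩
        rwa [Int.toNat_of_nonneg (by omega), add_sub_cancel_right]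
      · rintro ⟨u, ⟨h1, h2⟩, rfl⟩
        exact ⟨h2, by omega, by omega⟩
    rw [hcard, lt_div_iff₀ (by positivity)] at hn
    have hne : E.Nonempty := by
      rw [← Finset.card_pos]
      have : (0 : ℝ) < E.card := lt_trans (by positivity) hn
      exact_mod_cast this
    refine ⟨2 * n + 1, by omega, E, Finset.filter_subset _ _, by push_cast; exact hn.le,
      fun σ => ?_⟩
    obtain ⟨x, hx⟩ := hJ.exists_mem (E.image fun s : ℕ => (s : ℤ) - n) (hne.image _) (by
      intro s hs
      obtain ⟨u, hu, rfl⟩ := Finset.mem_image.1 (Finset.mem_coe.1 hs)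
      exact (Finset.mem_filter.1 hu).2) fun u => σ (u + n).toNat
    refine ⟨(T.toEquiv ^ (-(n : ℤ)) : Equiv.Perm X) x, fun s hs => ?_⟩
    have h1 := hx _ (Finset.mem_image_of_mem _ hs)
    simp only [sub_add_cancel, Int.toNat_natCast] at h1
    change (T.toEquiv : X → X)^[s] _ ∈ _
    rw [Equiv.Perm.iterate_eq_pow T.toEquiv, ← zpow_natCast, ← Equiv.Perm.mul_apply, ← zpow_add,
      ← sub_eq_add_neg]
    exact h1

/-- From here on, limits of densities and the distinction between the two acting semigroups no
longer matter. -/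
theorem DynSys.mem_IE_iff {X : Type*} [TopologicalSpace X] (S : DynSys X) {k : ℕ} (hk : 0 < k)
    (x : Fin k → X) :
    x ∈ S.IE k ↔ ∀ U : Fin k → Set X, (∀ i, U i ∈ 𝓝 (x i)) → PosIndep S.map U :=
  ⟨fun h U hU => (h U hU).posIndep, fun h U hU => (h U hU).hasPosDensityIndependenceSet hk S⟩

/-! ### Positive entropy yields independence -/

/-- The number of small subsets of `{0, …, n - 1}` grows with an arbitrarily small exponential
rate. -/
theorem exists_card_filter_powerset_le_exp {θ : ℝ} (hθ : 0 < θ) :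
    ∃ η : ℝ, 0 < η ∧ ∀ n : ℕ,
      ((((Finset.range n).powerset.filter fun J => (J.card : ℝ) ≤ η * n).card : ℕ) : ℝ) ≤
        Real.exp (θ * n) := by
  obtain ⟨x, hx0, hx1⟩ := exists_between (show (0 : ℝ) < min (1 / 2) (θ / 2) by positivity)
  have hxh := hx1.trans_le (min_le_left _ _)
  have hxθ := hx1.trans_le (min_le_right _ _)
  have hlog : Real.log x < 0 := Real.log_neg hx0 (by linarith)
  -- This η makes x ^ (η n) = exp(-θ n / 2). Every counted J thus has weight x ^ |J| at least that,
  -- while all weights sum to (1 + x) ^ n ≤ exp(θ n / 2).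
  refine ⟨θ / (2 * -Real.log x), div_pos hθ (by linarith), fun n => ?_⟩
  set η := θ / (2 * -Real.log x) with hη
  have hηx : η * Real.log x = -(θ / 2) := by
    have := hlog.ne
    rw [hη]
    field_simp
  have h1 : ∀ J ∈ (Finset.range n).powerset.filter fun J => (J.card : ℝ) ≤ η * n,
      Real.exp (-(θ / 2) * n) ≤ x ^ J.card := by
    intro J hJ
    have hJ' := (Finset.mem_filter.1 hJ).2
    rw [← Real.rpow_natCast, Real.rpow_def_of_pos hx0, Real.exp_le_exp, ← hηx]
    nlinarith
  have h2 := Finset.card_nsmul_le_sum _ _ _ h1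
  rw [nsmul_eq_mul] at h2
  have h3 : ∑ J ∈ (Finset.range n).powerset.filter (fun J => (J.card : ℝ) ≤ η * n), x ^ J.card ≤
      (x + 1) ^ n := by
    have := Finset.sum_pow_mul_eq_add_pow x 1 (Finset.range n)
    rw [Finset.card_range] at this
    rw [← this]
    simp only [one_pow, mul_one]
    exact Finset.sum_le_sum_of_subset_of_nonneg (Finset.filter_subset _ _)
      fun J _ _ => pow_nonneg hx0.le _
  have h4 : (x + 1) ^ n ≤ Real.exp (θ / 2 * n) := by
    calc (x + 1) ^ n ≤ (Real.exp x) ^ n := by gcongr; exact Real.add_one_le_exp x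
      _ = Real.exp (n * x) := (Real.exp_nat_mul x n).symm
      _ ≤ _ := by
        rw [Real.exp_le_exp, mul_comm]
        gcongr
  have h5 := h2.trans (h3.trans h4)
  have h6 : Real.exp (θ * n) = Real.exp (θ / 2 * n) / Real.exp (-(θ / 2) * n) := by
    rw [← Real.exp_sub]; congr 1; ring
  rwa [h6, le_div_iff₀ (Real.exp_pos _)]

section
variable {X : Type*} (T : X → X) (f : X → ℝ)

open scoped Classical in
/-- The times `i < n` at which `f` takes a value in `(a, b)` along the orbit of `x`. -/
noncomputable def visitTimes (n : ℕ) (a b : ℝ) (x : X) : Finset ℕ :=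
  (Finset.range n).filter fun i => f (T^[i] x) ∈ Ioo a b

open scoped Classical in
/-- The times `i < n` at which `f` takes a value at most `a` along the orbit of `x`. -/
noncomputable def lowTimes (n : ℕ) (a : ℝ) (x : X) : Finset ℕ :=
  (Finset.range n).filter fun i => f (T^[i] x) ≤ a

variable {T f}

theorem mem_visitTimes {n : ℕ} {a b : ℝ} {x : X} {i : ℕ} :
    i ∈ visitTimes T f n a b x ↔ i < n ∧ f (T^[i] x) ∈ Ioo a b := by
  simp only [visitTimes, Finset.mem_filter, Finset.mem_range]

theorem mem_lowTimes {n : ℕ} {a : ℝ} {x : X} {i : ℕ} :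
    i ∈ lowTimes T f n a x ↔ i < n ∧ f (T^[i] x) ≤ a := by
  simp only [lowTimes, Finset.mem_filter, Finset.mem_range]

/-- Among disjoint intervals there is one that the orbit visits rarely. -/
theorem exists_card_visitTimes_le {q : ℕ} (hq : 0 < q) (n : ℕ) (a : ℕ → ℝ) (ha : Monotone a)
    (x : X) : ∃ l < q, q * (visitTimes T f n (a l) (a (l + 1)) x).card ≤ n := by
  by_contra! hcon
  have h1 : ∑ l ∈ Finset.range q, (visitTimes T f n (a l) (a (l + 1)) x).card ≤ n := by
    rw [← Finset.card_biUnion]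
    · calc _ ≤ (Finset.range n).card := Finset.card_le_card fun i hi => by
            obtain ⟨l, -, hl⟩ := Finset.mem_biUnion.1 hi
            exact Finset.mem_range.2 (mem_visitTimes.1 hl).1
        _ = n := Finset.card_range n
    · intro l _ l' _ hll
      rw [Function.onFun, Finset.disjoint_left]
      intro i hi hi'
      obtain ⟨-, h2, h3⟩ := mem_visitTimes.1 hi
      obtain ⟨-, h4, h5⟩ := mem_visitTimes.1 hi'
      rcases lt_or_gt_of_ne hll with h | h
      · have := ha (Nat.succ_le_of_lt h)
        rw [Nat.succ_eq_add_one] at this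
        linarith
      · have := ha (Nat.succ_le_of_lt h)
        rw [Nat.succ_eq_add_one] at this
        linarith
  have h2 : ∑ _l ∈ Finset.range q, n < ∑ l ∈ Finset.range q,
      q * (visitTimes T f n (a l) (a (l + 1)) x).card :=
    Finset.sum_lt_sum_of_nonempty ⟨0, Finset.mem_range.2 hq⟩
      fun l hl => hcon l (Finset.mem_range.1 hl)
  rw [← Finset.mul_sum, Finset.sum_const, Finset.card_range, smul_eq_mul] at h2
  exact absurd (Nat.lt_of_mul_lt_mul_left h2) (not_lt.2 h1)

open scoped Classical in
/-- The sets of low times of orbits with a prescribed set of visit times. -/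
noncomputable def lowFamily (T : X → X) (f : X → ℝ) (n : ℕ) (a b : ℝ) (Q : Finset ℕ) :
    Finset (Finset ℕ) :=
  (Finset.range n).powerset.filter fun D =>
    ∃ x, visitTimes T f n a b x = Q ∧ lowTimes T f n a x = D

theorem mem_lowFamily {n : ℕ} {a b : ℝ} {Q D : Finset ℕ} :
    D ∈ lowFamily T f n a b Q ↔ ∃ x, visitTimes T f n a b x = Q ∧ lowTimes T f n a x = D := by
  simp only [lowFamily, Finset.mem_filter, Finset.mem_powerset, and_iff_right_iff_imp]
  rintro ⟨x, -, rfl⟩ i hi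
  exact Finset.mem_range.2 (mem_lowTimes.1 hi).1

/-- With the visit times fixed to be Q, at a time outside Q a point is either low or at least b. A
shattered J avoids Q, since some orbit is low on all of J; hence each low/non-low pattern on J is a
low/high pattern. -/
theorem indepOn_of_shatters_lowFamily {n : ℕ} {a b : ℝ} {Q J : Finset ℕ}
    (hJ : (lowFamily T f n a b Q).Shatters J) :
    J ⊆ Finset.range n ∧ IndepOn T ![{x | f x ≤ a}, {x | b ≤ f x}] J := by
  have hJn : ∀ i ∈ J, i < n ∧ i ∉ Q := by
    intro i hi
    obtain ⟨D, hD, hDJ⟩ := hJ (subset_refl J)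
    obtain ⟨x, rfl, rfl⟩ := mem_lowFamily.1 hD
    have : i ∈ lowTimes T f n a x := (Finset.mem_inter.1 (by rw [hDJ]; exact hi)).2
    obtain ⟨h1, h2⟩ := mem_lowTimes.1 this
    exact ⟨h1, fun h => absurd (mem_visitTimes.1 h).2.1 (not_lt.2 h2)⟩
  refine ⟨fun i hi => Finset.mem_range.2 (hJn i hi).1, fun σ => ?_⟩
  obtain ⟨D, hD, hDJ⟩ := hJ (Finset.filter_subset (fun i => σ i = 0) J)
  obtain ⟨x, hxQ, rfl⟩ := mem_lowFamily.1 hD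
  refine ⟨x, fun i hi => ?_⟩
  obtain ⟨hin, hiQ⟩ := hJn i hi
  have h1 : i ∈ J ∩ lowTimes T f n a x ↔ i ∈ J.filter fun i => σ i = 0 := by rw [hDJ]
  rw [Finset.mem_inter, Finset.mem_filter, mem_lowTimes] at h1
  by_cases h0 : σ i = 0
  · rw [h0]
    exact (h1.2 ⟨hi, h0⟩).2.2
  · have h2 : σ i = 1 := Fin.eq_one_of_ne_zero _ h0
    rw [h2]
    have h3 : a < f (T^[i] x) := by
      by_contra h
      exact h0 (h1.1 ⟨hi, hin, not_lt.1 h⟩).2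
    by_contra h
    exact hiQ (hxQ ▸ mem_visitTimes.2 ⟨hin, h3, not_le.1 h⟩)

/-- Pajor's form of Sauer–Shelah: a family has at most as many members as it shatters sets, and here
the shattered sets are independence sets, hence small. -/
theorem card_lowFamily_le {n : ℕ} {a b η : ℝ} {Q : Finset ℕ}
    (h : ∀ E ⊆ Finset.range n, IndepOn T ![{x | f x ≤ a}, {x | b ≤ f x}] E →
      (E.card : ℝ) ≤ η * n) :
    (lowFamily T f n a b Q).card ≤
      ((Finset.range n).powerset.filter fun J => (J.card : ℝ) ≤ η * n).card := by
  refine Finset.card_le_card_shatterer _ |>.trans (Finset.card_le_card fun J hJ => ?_)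
  obtain ⟨h1, h2⟩ := indepOn_of_shatters_lowFamily (Finset.mem_shatterer.1 hJ)
  exact Finset.mem_filter.2 ⟨Finset.mem_powerset.2 h1, h J h1 h2⟩

end

section
variable {X : Type*} [MetricSpace X] {T : X → X}

open scoped Classical in
/-- The number of codes (rarely visited shell, visit times, low times) of orbit segments. -/
theorem minSubcoverCard_iteratedJoin_le {𝒰 : Set (Set X)} {δ : ℝ} (hδ : 0 < δ)
    (P : Finset X) (hP : ∀ x, ∃ p ∈ P, dist x p < δ / 2)
    (h𝒰 : ∀ p, ∃ U ∈ 𝒰, Metric.ball p δ ⊆ U) {q : ℕ} (hq : 0 < q) {η : ℝ} (hqη : 1 ≤ q * η)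
    {n : ℕ} (hn : ∀ p ∈ P, ∀ l < q, ∀ E ⊆ Finset.range n,
      IndepOn T ![{x | dist x p ≤ δ / 2 + l * (δ / (2 * q))},
        {x | δ / 2 + (l + 1 : ℕ) * (δ / (2 * q)) ≤ dist x p}] E → (E.card : ℝ) ≤ η * n) :
    minSubcoverCard (iteratedJoin T 𝒰 n) ≤ (q *
      ((Finset.range n).powerset.filter fun J => (J.card : ℝ) ≤ η * n).card ^ 2) ^ P.card := by
  have hq' : (0 : ℝ) < q := by exact_mod_cast hq
  -- Radii cutting the shell between δ/2 and δ into q thin shells. Each orbit segment rarely visits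
  -- one of them, so both its visit times there and, given these, its low times have few possible
  -- values.
  let a : ℕ → ℝ := fun l => δ / 2 + l * (δ / (2 * q))
  have ha : Monotone a := fun l l' h => by
    simp only [a]; gcongr
  have ha0 : ∀ l, δ / 2 ≤ a l := fun l => by
    simp only [a, le_add_iff_nonneg_right]; positivity
  have haq : ∀ l < q, a l < δ := fun l hl => by
    have h1 : (l : ℝ) * (δ / (2 * q)) < q * (δ / (2 * q)) := by gcongr
    have h2 : (q : ℝ) * (δ / (2 * q)) = δ / 2 := by field_simp
    simp only [a]; linarith
  let f : X → X → ℝ := fun p x => dist x p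
  choose zone hzone hvisit using fun (p x : X) =>
    exists_card_visitTimes_le (T := T) (f := f p) hq n a ha x
  set 𝒬 := (Finset.range n).powerset.filter fun J => (J.card : ℝ) ≤ η * n with h𝒬
  let fam : X → ℕ → Finset ℕ → Finset (Finset ℕ) := fun p l Q =>
    lowFamily T (f p) n (a l) (a (l + 1)) Q
  let codes : X → Finset (Σ _ : ℕ × Finset ℕ, Finset ℕ) := fun p =>
    (Finset.range q ×ˢ 𝒬).sigma fun lQ => fam p lQ.1 lQ.2
  let code : X → X → (Σ _ : ℕ × Finset ℕ, Finset ℕ) := fun x p =>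
    ⟨(zone p x, visitTimes T (f p) n (a (zone p x)) (a (zone p x + 1)) x),
      lowTimes T (f p) n (a (zone p x)) x⟩
  have hcodes : ∀ p ∈ P, (codes p).card ≤ q * 𝒬.card ^ 2 := by
    intro p hp
    rw [Finset.card_sigma]
    calc _ ≤ ∑ _lQ ∈ Finset.range q ×ˢ 𝒬, 𝒬.card := Finset.sum_le_sum fun lQ hlQ =>
          card_lowFamily_le (hn p hp lQ.1 (Finset.mem_range.1 (Finset.mem_product.1 hlQ).1))
      _ = _ := by simp [Finset.card_product, pow_two, mul_assoc]
  have hcode : ∀ x p, code x p ∈ codes p := by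
    intro x p
    refine Finset.mem_sigma.2 ⟨Finset.mem_product.2 ⟨Finset.mem_range.2 (hzone p x),
      Finset.mem_filter.2 ⟨Finset.mem_powerset.2 fun i hi =>
        Finset.mem_range.2 (mem_visitTimes.1 hi).1, ?_⟩⟩, mem_lowFamily.2 ⟨x, rfl, rfl⟩⟩
    have h1 : (q : ℝ) * (visitTimes T (f p) n (a (zone p x)) (a (zone p x + 1)) x).card ≤ n := by
      exact_mod_cast hvisit p x
    have h2 : (n : ℝ) ≤ q * (η * n) := by
      rw [← mul_assoc]; exact le_mul_of_one_le_left (Nat.cast_nonneg _) hqη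
    exact le_of_mul_le_mul_left (h1.trans h2) hq'
  have hclass : ∀ x : X, ∃ V ∈ iteratedJoin T 𝒰 n,
      ∀ y, (∀ p ∈ P, code y p = code x p) → y ∈ V := by
    intro x
    have h1 : ∀ i : Fin n, ∃ U : 𝒰, ∀ y, (∀ p ∈ P, code y p = code x p) →
        T^[(i : ℕ)] y ∈ (U : Set X) := by
      intro i
      obtain ⟨p, hp, hpx⟩ := hP (T^[(i : ℕ)] x)
      obtain ⟨U, hU, hpU⟩ := h𝒰 p
      refine ⟨⟨U, hU⟩, fun y hy => hpU ?_⟩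
      -- At time i the orbit of x is within δ/2 of p, below every shell. Equality of codes puts y at
      -- that time below the inner radius of its own shell, still less than δ.
      have h2 : (i : ℕ) ∈ (code x p).2 := mem_lowTimes.2 ⟨i.2, hpx.le.trans (ha0 _)⟩
      rw [← hy p hp] at h2
      exact Metric.mem_ball.2 ((mem_lowTimes.1 h2).2.trans_lt (haq _ (hzone p y)))
    choose V hV using h1
    exact ⟨_, ⟨V, rfl⟩, fun y hy => mem_iInter.2 fun i => hV i y hy⟩
  choose V hV hVcode using hclass
  let κ := (p : X) → p ∈ P → (Σ _ : ℕ × Finset ℕ, Finset ℕ)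
  let all : Finset κ := P.pi codes
  let restr : X → κ := fun x p _ => code x p
  have hrestr : ∀ x, restr x ∈ all := fun x => Finset.mem_pi.2 fun p _ => hcode x p
  let real : Finset κ := all.filter fun c => ∃ x, restr x = c
  have hreal : ∀ c : κ, ∃ W : Set X, (c ∈ real → W ∈ iteratedJoin T 𝒰 n) ∧
      ∀ y, restr y = c → y ∈ W := by
    intro c
    by_cases hc : ∃ x, restr x = c
    · obtain ⟨x, rfl⟩ := hc
      exact ⟨V x, fun _ => hV x, fun y hy => hVcode x y fun p hp => congrFun (congrFun hy p) hp⟩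
    · exact ⟨∅, fun h => absurd (Finset.mem_filter.1 h).2 hc, fun y hy => absurd ⟨y, hy⟩ hc⟩
  choose W hW hWmem using hreal
  have hmin : minSubcoverCard (iteratedJoin T 𝒰 n) ≤ (real.image W).card := by
    refine Nat.sInf_le ⟨real.image W, ?_, ?_, rfl⟩
    · intro U hU
      obtain ⟨c, hc, rfl⟩ := Finset.mem_image.1 (Finset.mem_coe.1 hU)
      exact hW c hc
    · refine eq_univ_of_forall fun x => mem_sUnion.2 ⟨W (restr x), ?_, hWmem _ x rfl⟩
      exact Finset.mem_coe.2 (Finset.mem_image_of_mem _ (Finset.mem_filter.2 ⟨hrestr x, x, rfl⟩))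
  calc _ ≤ all.card := hmin.trans (Finset.card_image_le.trans (Finset.card_filter_le _ _))
    _ = ∏ p ∈ P, (codes p).card := Finset.card_pi _ _
    _ ≤ ∏ _p ∈ P, q * 𝒬.card ^ 2 := Finset.prod_le_prod' hcodes
    _ = _ := by rw [Finset.prod_const]

/-- Positive topological entropy yields a pair of disjoint closed sets with positive independence
density. -/
theorem exists_posIndep_of_topEntropy_pos [CompactSpace X] (h : 0 < topEntropy T) :
    ∃ (p : X) (a b : ℝ), a < b ∧ PosIndep T ![{x | dist x p ≤ a}, {x | b ≤ dist x p}] := by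
  by_contra! hcon
  refine absurd h (not_lt.2 (iSup₂_le fun 𝒰 h𝒰 => ?_))
  obtain ⟨hopen, hcov⟩ := h𝒰
  obtain ⟨δ, hδ, hLeb⟩ := lebesgue_number_lemma_of_metric_sUnion (isCompact_univ (X := X)) hopen
    hcov.ge
  obtain ⟨P', -, hPfin, hPcov⟩ := finite_cover_balls_of_compact (isCompact_univ (X := X))
    (half_pos hδ)
  set P := hPfin.toFinset with hPdef
  have hP : ∀ x, ∃ p ∈ P, dist x p < δ / 2 := fun x => by
    obtain ⟨p, hp, hxp⟩ := mem_iUnion₂.1 (hPcov (mem_univ x))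
    exact ⟨p, hPfin.mem_toFinset.2 hp, hxp⟩
  by_contra! hpos
  obtain ⟨κ, hκ0, hκ⟩ := EReal.lt_iff_exists_real_btwn.1 hpos
  have hκ0' : 0 < κ := by exact_mod_cast hκ0
  refine absurd hκ (not_lt.2 ?_)
  set r : ℝ := (P.card : ℝ) with hr
  have hr0 : 0 ≤ r := Nat.cast_nonneg _
  -- The logarithm of the bound on codes is r log q + 2 r θ n. The second term is at most κ n / 2 by
  -- this choice, the first for large n.
  set θ := κ / (4 * (r + 1)) with hθdef
  have hθ : 0 < θ := by positivity
  obtain ⟨η, hη, hB⟩ := exists_card_filter_powerset_le_exp hθ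
  obtain ⟨q, hq⟩ := exists_nat_ge (1 / η)
  rw [div_le_iff₀ hη] at hq
  have hq0 : 0 < q := by
    rcases Nat.eq_zero_or_pos q with rfl | h
    · norm_num at hq
    · exact h
  have hq1 : (1 : ℝ) ≤ q := by exact_mod_cast hq0
  have hq0' : (0 : ℝ) < q := by exact_mod_cast hq0
  have hev : ∀ᶠ n : ℕ in atTop, ∀ p ∈ P, ∀ l ∈ Finset.range q, ∀ E ⊆ Finset.range n,
      IndepOn T ![{x | dist x p ≤ δ / 2 + l * (δ / (2 * q))},
        {x | δ / 2 + (l + 1 : ℕ) * (δ / (2 * q)) ≤ dist x p}] E → (E.card : ℝ) ≤ η * n := by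
    rw [Finset.eventually_all]
    intro p _
    rw [Finset.eventually_all]
    intro l _
    have hlt : δ / 2 + l * (δ / (2 * q)) < δ / 2 + (l + 1 : ℕ) * (δ / (2 * q)) := by
      gcongr
      omega
    have h1 := hcon p _ _ hlt
    by_contra h2
    refine h1 ⟨η, hη, (not_eventually.1 h2).mono fun n hn => ?_⟩
    push Not at hn
    obtain ⟨E, hE1, hE2, hE3⟩ := hn
    exact ⟨E, hE1, hE3.le, hE2⟩
  have hlarge : ∀ᶠ n : ℕ in atTop, 2 * (r * Real.log q) / κ < n :=
    tendsto_natCast_atTop_atTop.eventually (eventually_gt_atTop _)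
  refine limsup_le_of_le (by isBoundedDefault) ?_
  filter_upwards [hev, hlarge, eventually_gt_atTop 0] with n hn hnl hn0
  rw [EReal.coe_le_coe_iff]
  have hn0' : (0 : ℝ) < n := by exact_mod_cast hn0
  rw [div_le_iff₀ hn0']
  rcases Nat.eq_zero_or_pos (minSubcoverCard (iteratedJoin T 𝒰 n)) with h0 | h0
  -- The degenerate value 0 is harmless because `Real.log 0 = 0`.
  · rw [h0]; simp only [Nat.cast_zero, Real.log_zero]; positivity
  have h1 := minSubcoverCard_iteratedJoin_le hδ P hP (fun p => hLeb p (mem_univ p)) hq0 hq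
    (fun p hp l hl => hn p hp l (Finset.mem_range.2 hl))
  have h2 : (minSubcoverCard (iteratedJoin T 𝒰 n) : ℝ) ≤
      (q * Real.exp (θ * n) ^ 2) ^ P.card := by
    refine (Nat.cast_le.2 h1).trans ?_
    push_cast
    gcongr
    convert hB n
  have h3 := Real.log_le_log (by exact_mod_cast h0) h2
  rw [Real.log_pow, Real.log_mul hq0'.ne' (by positivity), Real.log_pow, Real.log_exp] at h3
  have h4 : r * (2 * (θ * n)) ≤ κ / 2 * n := by
    have : r * θ ≤ κ / 4 := by
      rw [hθdef, mul_div_assoc', div_le_div_iff₀ (by positivity) (by positivity)]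
      nlinarith
    nlinarith
  rw [div_lt_iff₀ hκ0'] at hnl
  push_cast at h3
  rw [← hr] at h3
  nlinarith

end

/-! ### Compactness and the construction of the Cantor sets -/

section
variable {X : Type*} [MetricSpace X] [CompactSpace X] {T : X → X}

/-- A tuple of closed sets with positive independence density contains a tuple of points all of
whose neighbourhoods have positive independence density. -/
theorem PosIndep.exists_points {ι : Type*} [Finite ι] {A : ι → Set X} (h : PosIndep T A)
    (hA : ∀ i, IsClosed (A i)) :
    ∃ x : ι → X, (∀ i, x i ∈ A i) ∧
      ∀ U : ι → Set X, (∀ i, U i ∈ 𝓝 (x i)) → PosIndep T U := by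
  cases nonempty_fintype ι
  by_contra! hcon
  have hcomp : IsCompact (Set.pi univ A) := isCompact_univ_pi fun i => (hA i).isCompact
  have h1 : ∀ x : Set.pi univ A, ∃ U : ι → Set X, (∀ i, IsOpen (U i)) ∧
      (∀ i, x.1 i ∈ U i) ∧ ¬ PosIndep T U := by
    rintro ⟨x, hx⟩
    obtain ⟨U, hU, hUn⟩ := hcon x fun i => hx i (mem_univ i)
    exact ⟨fun i => interior (U i), fun i => isOpen_interior,
      fun i => mem_interior_iff_mem_nhds.2 (hU i), fun h => hUn (h.mono id fun i => interior_subset)⟩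
  choose U hUo hxU hU using h1
  obtain ⟨δ, hδ, hLeb⟩ := lebesgue_number_lemma_of_metric hcomp
    (c := fun x => Set.pi univ (U x)) (fun x => isOpen_set_pi finite_univ fun i _ => hUo x i)
    (fun x hx => mem_iUnion.2 ⟨⟨x, hx⟩, fun i _ => hxU ⟨x, hx⟩ i⟩)
  -- Cells cut by balls of radius δ/2 lie within δ of any chosen point x of the product of cells. By
  -- the Lebesgue number a product of such cells would fit into one of the neighbourhoods assumed
  -- not to be `PosIndep`.
  obtain ⟨P, -, hP, hcov⟩ := finite_cover_balls_of_compact (isCompact_univ (X := X))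
    (half_pos hδ)
  have := hP.to_subtype
  obtain ⟨f, hf⟩ := h.exists_inter (fun p : P => Metric.ball (p : X) (δ / 2))
    (by rw [iUnion_subtype]; exact univ_subset_iff.1 hcov)
  choose x hx using hf.nonempty
  obtain ⟨y, hy⟩ := hLeb x fun i _ => (hx i).1
  refine hU y (hf.mono id fun i z hz => ?_)
  classical
  have h2 : Function.update x i z ∈ Metric.ball x δ := by
    rw [Metric.mem_ball, dist_pi_lt_iff hδ]
    intro j
    by_cases hj : j = i
    · subst hj
      rw [Function.update_self]
      have h3 := Metric.mem_ball.1 hz.2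
      have h4 := Metric.mem_ball'.1 (hx j).2
      exact (dist_triangle _ _ _).trans_lt (by simp only [id] at h3; linarith)
    · rw [Function.update_of_ne hj, dist_self]
      exact hδ
  simpa using hy h2 i (mem_univ i)

/-- The inductive step in the construction of the Cantor sets. -/
theorem PosIndep.exists_refinement (hT : Continuous T) {ι κ : Type*} [Finite ι] [Finite κ]
    {A : ι → Set X} (h : PosIndep T A) (hA : ∀ i, IsClosed (A i)) (p : κ → ι) (N : ℕ) {ε : ℝ}
    (hε : 0 < ε) :
    ∃ A' : κ → Set X, (∀ u, IsClosed (A' u)) ∧ PosIndep T A' ∧ (∀ u, A' u ⊆ A (p u)) ∧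
      (∀ u, ∀ x ∈ A' u, ∀ y ∈ A' u, dist x y ≤ ε) ∧
      ∀ φ : κ → ι, ∃ s, N ≤ s ∧ ∀ u, MapsTo T^[s] (A' u) (A (φ u)) := by
  -- One return time for each assignment φ. The u-th new set follows the prescription φ ↦ φ u, so at
  -- time s φ it enters `A (φ u)`, for all u at once.
  obtain ⟨s, hsN, hs⟩ := h.exists_iInter_preimage (κ := κ → ι) N
  have h1 : PosIndep T fun u => A (p u) ∩ ⋂ φ : κ → ι, T^[s φ] ⁻¹' A (φ u) :=
    hs.mono (fun u => (p u, fun φ => φ u)) fun u => subset_rfl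
  obtain ⟨P, -, hP, hcov⟩ := finite_cover_balls_of_compact (isCompact_univ (X := X))
    (half_pos hε)
  have := hP.to_subtype
  obtain ⟨f, hf⟩ := h1.exists_inter (fun q : P => Metric.closedBall (q : X) (ε / 2)) (by
    refine univ_subset_iff.1 (hcov.trans ?_)
    rw [iUnion_subtype]
    exact iUnion₂_mono fun q _ => Metric.ball_subset_closedBall)
  refine ⟨_, fun u => ?_, hf, fun u x hx => hx.1.1, fun u x hx y hy => ?_, fun φ =>
    ⟨s φ, hsN φ, fun u x hx => mem_iInter.1 hx.1.2 φ⟩⟩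
  · exact ((hA _).inter (isClosed_iInter fun φ => (hA _).preimage (hT.iterate _))).inter
      Metric.isClosed_closedBall
  · have h3 := Metric.mem_closedBall.1 hx.2
    have h4 := Metric.mem_closedBall'.1 hy.2
    exact (dist_triangle _ _ _).trans (by linarith)

/-- The initial segment of length `n` of a labelled binary sequence. -/
def initWord {ι : Type*} (n : ℕ) (y : ι × (ℕ → Bool)) : ι × (Fin n → Bool) :=
  (y.1, fun l => y.2 l)

/-- Removing the last letter of a labelled binary word. -/
def parentWord {ι : Type*} (n : ℕ) (w : ι × (Fin (n + 1) → Bool)) : ι × (Fin n → Bool) :=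
  (w.1, fun l => w.2 l.castSucc)

theorem eventually_initWord_ne {ι : Type*} {y y' : ι × (ℕ → Bool)} (h : y ≠ y') :
    ∀ᶠ n in atTop, initWord n y ≠ initWord n y' := by
  by_cases h1 : y.1 = y'.1
  · obtain ⟨l, hl⟩ := Function.ne_iff.1 fun h2 => h (Prod.ext h1 h2)
    filter_upwards [eventually_gt_atTop l] with n hn heq
    exact hl (congrFun (congrArg Prod.snd heq) ⟨l, hn⟩)
  · exact Eventually.of_forall fun n heq => h1 (Prod.ext_iff.1 heq).1

/-- Iterating the refinement step along binary words. The last clause drives the rest: the freedom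
in φ yields both the disjointness of the sets of a level and the simultaneous approach to arbitrary
targets. -/
theorem exists_cantor_scheme (hT : Continuous T) {ι : Type*} [Finite ι] {A : ι → Set X}
    (h : PosIndep T A) (hA : ∀ i, IsClosed (A i)) :
    ∃ F : (n : ℕ) → ι × (Fin n → Bool) → Set X, (∀ w, F 0 w = A w.1) ∧
      (∀ n w, IsClosed (F n w)) ∧ (∀ n, PosIndep T (F n)) ∧
      (∀ n w, F (n + 1) w ⊆ F n (parentWord n w)) ∧
      (∀ n w, ∀ x ∈ F (n + 1) w, ∀ y ∈ F (n + 1) w, dist x y ≤ (1 / 2) ^ n) ∧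
      ∀ n, ∀ φ : ι × (Fin (n + 1) → Bool) → ι × (Fin n → Bool), ∃ s, n ≤ s ∧
        ∀ w, MapsTo T^[s] (F (n + 1) w) (F n (φ w)) := by
  have hstep := fun (n : ℕ) (F : {F : ι × (Fin n → Bool) → Set X //
      PosIndep T F ∧ ∀ w, IsClosed (F w)}) =>
    F.2.1.exists_refinement hT F.2.2 (parentWord n) n (ε := (1 / 2) ^ n) (by positivity)
  choose G hG1 hG2 hG3 hG4 hG5 using hstep
  let F : (n : ℕ) → {F : ι × (Fin n → Bool) → Set X // PosIndep T F ∧ ∀ w, IsClosed (F w)} :=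
    fun n => Nat.rec ⟨fun w => A w.1, h.mono Prod.fst fun _ => subset_rfl, fun w => hA _⟩
      (fun n F => ⟨G n F, hG2 n F, hG1 n F⟩) n
  exact ⟨fun n => (F n).1, fun _ => rfl, fun n => (F n).2.2, fun n => (F n).2.1,
    fun n => hG3 n (F n), fun n => hG4 n (F n), fun n => hG5 n (F n)⟩

/-- The Cantor sets inside a tuple of closed sets with positive independence density. -/
theorem PosIndep.exists_cantor (hT : Continuous T) {ι : Type*} [Finite ι] {A : ι → Set X}
    (h : PosIndep T A) (hA : ∀ i, IsClosed (A i)) {a b : ι} (hab : Disjoint (A a) (A b)) :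
    ∃ π : ι × (ℕ → Bool) → X, (∀ i, Continuous fun z => π (i, z)) ∧ Function.Injective π ∧
      (∀ y, π y ∈ A y.1) ∧
      (∀ (m : ℕ) (y : Fin m → ι × (ℕ → Bool)) (U : Fin m → Set X),
        (∀ i, U i ∈ 𝓝 (π (y i))) → PosIndep T U) ∧
      (∀ (m : ℕ) (y y' : Fin m → ι × (ℕ → Bool)), Function.Injective y → ∀ ε > 0,
        ∃ᶠ n in atTop, ∀ i, dist (T^[n] (π (y i))) (π (y' i)) < ε) := by
  obtain ⟨F, hF0, hFcl, hFpos, hFsub, hFdiam, hFmap⟩ := exists_cantor_scheme hT h hA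
  have hanti : ∀ y : ι × (ℕ → Bool), ∀ n, F (n + 1) (initWord (n + 1) y) ⊆ F n (initWord n y) :=
    fun y n => hFsub n (initWord (n + 1) y)
  have hpt : ∀ y : ι × (ℕ → Bool), ∃ x, ∀ n, x ∈ F n (initWord n y) := by
    intro y
    obtain ⟨x, hx⟩ := IsCompact.nonempty_iInter_of_sequence_nonempty_isCompact_isClosed
      (fun n => F n (initWord n y)) (hanti y) (fun n => (hFpos n).nonempty _)
      (hFcl 0 _).isCompact (fun n => hFcl n _)
    exact ⟨x, fun n => mem_iInter.1 hx n⟩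
  choose π hπ using hpt
  have hsmall : ∀ ε > (0 : ℝ), ∀ᶠ n : ℕ in atTop, (1 / 2 : ℝ) ^ n < ε := fun ε hε =>
    (tendsto_pow_atTop_nhds_zero_of_lt_one (by norm_num) (by norm_num)).eventually
      (gt_mem_nhds hε)
  have hFA : ∀ n w, F n w ⊆ A w.1 := by
    intro n
    induction n with
    | zero => exact fun w => (hF0 w).le
    | succ n ih => exact fun w => (hFsub n w).trans (ih _)
  have hdisj : ∀ n w w', w ≠ w' → Disjoint (F (n + 1) w) (F (n + 1) w') := by
    classical
    intro n w w' hw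
    -- Distinct words of one level are separated dynamically: a common iterate sends one set into `A
    -- a` and the other into `A b`.
    obtain ⟨s, -, hs⟩ := hFmap n fun v => (if v = w then a else b, fun _ => false)
    rw [Set.disjoint_left]
    intro x hx hx'
    have h1 := hFA _ _ (hs w hx)
    have h2 := hFA _ _ (hs w' hx')
    rw [if_pos rfl] at h1
    rw [if_neg hw.symm] at h2
    exact Set.disjoint_left.1 hab h1 h2
  refine ⟨π, fun i => ?_, fun y y' hyy => ?_, fun y => hFA 0 _ (hπ y 0), fun m y U hU => ?_,
    fun m y y' hy ε hε => ?_⟩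
  · refine continuous_iff_continuousAt.2 fun z => Metric.tendsto_nhds.2 fun ε hε => ?_
    obtain ⟨n, hn⟩ := (hsmall ε hε).exists
    have h1 : ∀ᶠ z' in 𝓝 z, ∀ l ∈ Finset.range (n + 1), z' l = z l := by
      rw [Finset.eventually_all]
      intro l _
      exact (continuous_apply l).continuousAt.eventually
        (show ∀ᶠ b in 𝓝 (z l), b = z l by simp [nhds_discrete])
    filter_upwards [h1] with z' hz'
    have h2 : initWord (n + 1) (i, z') = initWord (n + 1) (i, z) :=
      Prod.ext rfl (funext fun l => hz' l (Finset.mem_range.2 l.2))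
    refine (hFdiam n (initWord (n + 1) (i, z)) _ ?_ _ (hπ _ _)).trans_lt hn
    rw [← h2]
    exact hπ _ _
  · by_contra hne
    obtain ⟨n, hn, hn0⟩ := ((eventually_initWord_ne hne).and (eventually_gt_atTop 0)).exists
    obtain ⟨n, rfl⟩ := Nat.exists_eq_succ_of_ne_zero hn0.ne'
    exact Set.disjoint_left.1 (hdisj n _ _ hn) (hπ y _) (hyy ▸ hπ y' _)
  · have h1 : ∀ᶠ n : ℕ in atTop, ∀ i, F (n + 1) (initWord (n + 1) (y i)) ⊆ U i := by
      rw [eventually_all]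
      intro i
      obtain ⟨ε, hε, hεU⟩ := Metric.mem_nhds_iff.1 (hU i)
      filter_upwards [hsmall ε hε] with n hn x hx
      exact hεU (Metric.mem_ball.2 ((hFdiam n _ x hx _ (hπ (y i) _)).trans_lt hn))
    obtain ⟨n, hn⟩ := h1.exists
    exact (hFpos (n + 1)).mono _ hn
  · have h1 : ∀ᶠ n : ℕ in atTop, ∀ i j, i ≠ j → initWord n (y i) ≠ initWord n (y j) := by
      simp only [eventually_all]
      exact fun i j hij => eventually_initWord_ne fun h => hij (hy h)
    refine frequently_atTop.2 fun N => ?_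
    obtain ⟨n, ⟨hn1, hn2⟩, hn3⟩ := (((tendsto_add_atTop_nat 2).eventually h1).and
      (hsmall ε hε)).and (eventually_ge_atTop N) |>.exists
    have hinj : Function.Injective fun i => initWord (n + 2) (y i) := fun i j hij => by
      by_contra hne
      exact hn1 i j hne hij
    -- Once the initial words of the y i are distinct, sending each to the word of its target is a
    -- well-defined assignment; its value on other words is irrelevant.
    obtain ⟨s, hs, hsm⟩ := hFmap (n + 1) (Function.extend (fun i => initWord (n + 2) (y i))
      (fun i => initWord (n + 1) (y' i)) fun _ => (a, fun _ => false))
    refine ⟨s, by omega, fun i => ?_⟩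
    have h2 := hsm _ (hπ (y i) (n + 2))
    rw [hinj.extend_apply] at h2
    exact (hFdiam n _ _ h2 _ (hπ (y' i) (n + 1))).trans_lt hn2

end

/-! ### Li–Yorke pairs and the conclusion -/

theorem liminf_eq_zero_of_frequently_lt {u : ℕ → ℝ} {C : ℝ} (h0 : ∀ n, 0 ≤ u n) (hC : ∀ n, u n ≤ C)
    (h : ∀ ε > 0, ∃ᶠ n in atTop, u n < ε) : liminf u atTop = 0 := by
  have hb : IsBoundedUnder (· ≥ ·) atTop u := isBoundedUnder_of ⟨0, h0⟩
  have hb' : IsCoboundedUnder (· ≥ ·) atTop u :=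
    (isBoundedUnder_of (r := (· ≤ ·)) ⟨C, hC⟩).isCoboundedUnder_ge
  refine le_antisymm (le_of_forall_pos_le_add fun ε hε => ?_)
    (le_liminf_of_le hb' (Eventually.of_forall h0))
  rw [zero_add]
  exact liminf_le_of_frequently_le ((h ε hε).mono fun n hn => hn.le) hb

theorem isCantorSet_range {X : Type*} [MetricSpace X] {π : (ℕ → Bool) → X} (hc : Continuous π) (hi : Function.Injective π) :
    IsCantorSet (range π) :=
  ⟨(hc.isClosedEmbedding hi).isEmbedding.toHomeomorph.symm⟩

section
variable {X : Type*} [MetricSpace X] [CompactSpace X]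

theorem dist_le_diam_univ (x y : X) : dist x y ≤ Metric.diam (univ : Set X) :=
  Metric.dist_le_diam_of_mem isCompact_univ.isBounded (mem_univ x) (mem_univ y)

theorem mem_liYorkePairs_of_frequently {T : X → X} {x y : X} {δ : ℝ} (hδ : 0 < δ)
    (h1 : ∃ᶠ n in atTop, δ ≤ dist (T^[n] x) (T^[n] y))
    (h2 : ∀ ε > 0, ∃ᶠ n in atTop, dist (T^[n] x) (T^[n] y) < ε) : (x, y) ∈ liYorkePairs T := by
  refine ⟨hδ.trans_le (le_limsup_of_frequently_le h1
    (isBoundedUnder_of ⟨_, fun n => dist_le_diam_univ _ _⟩)), ?_⟩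
  exact liminf_eq_zero_of_frequently_lt (fun n => dist_nonneg) (fun n => dist_le_diam_univ _ _) h2

/-- Distinct points that simultaneously approach prescribed targets form a Li–Yorke pair. -/
theorem mem_liYorkePairs_of_approach {Y : Type*} {T : X → X} {π : Y → X}
    (hπ : Function.Injective π)
    (h : ∀ (m : ℕ) (y y' : Fin m → Y), Function.Injective y → ∀ ε > 0,
        ∃ᶠ n in atTop, ∀ i, dist (T^[n] (π (y i))) (π (y' i)) < ε) {y z : Y} (hyz : y ≠ z) :
    (π y, π z) ∈ liYorkePairs T := by
  have hinj : Function.Injective ![y, z] := by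
    intro i j
    fin_cases i <;> fin_cases j <;> simp [hyz, hyz.symm]
  have hd : 0 < dist (π y) (π z) := dist_pos.2 fun h => hyz (hπ h)
  refine mem_liYorkePairs_of_frequently (half_pos hd) ?_ fun ε hε => ?_
  · refine (h 2 ![y, z] ![y, z] hinj (dist (π y) (π z) / 4) (by positivity)).mono fun n hn => ?_
    have h1 := hn 0
    have h2 := hn 1
    simp only [Matrix.cons_val_zero, Matrix.cons_val_one] at h1 h2
    have h3 := dist_triangle4 (π y) (T^[n] (π y)) (T^[n] (π z)) (π z)
    rw [dist_comm (π y) (T^[n] (π y))] at h3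
    linarith
  · refine (h 2 ![y, z] ![y, y] hinj (ε / 2) (by positivity)).mono fun n hn => ?_
    have h1 := hn 0
    have h2 := hn 1
    simp only [Matrix.cons_val_zero, Matrix.cons_val_one] at h1 h2
    have h3 := dist_triangle_right (T^[n] (π y)) (T^[n] (π z)) (π y)
    linarith

/-- Nondiagonality supplies two different entries, and only their neighbourhoods have to be shrunk
to disjoint ones. -/
theorem DynSys.exists_cantor (S : DynSys X) {k : ℕ} {x : Fin k → X} (hk : 0 < k) (hx : x ∈ S.IE k)
    (hne : ¬ ∃ a : X, ∀ j, x j = a) {A : Fin k → Set X} (hA : ∀ j, A j ∈ 𝓝 (x j)) :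
    ∃ π : Fin k × (ℕ → Bool) → X, (∀ i, Continuous fun z => π (i, z)) ∧ Function.Injective π ∧
      (∀ y, π y ∈ A y.1) ∧
      (∀ m : ℕ, 0 < m → ∀ y : Fin m → Fin k × (ℕ → Bool), (fun i => π (y i)) ∈ S.IE m) ∧
      (∀ (m : ℕ) (y y' : Fin m → Fin k × (ℕ → Bool)), Function.Injective y → ∀ ε > 0,
        ∃ᶠ n in atTop, ∀ i, dist (S.map^[n] (π (y i))) (π (y' i)) < ε) := by
  rw [S.mem_IE_iff hk] at hx
  obtain ⟨b, hb⟩ : ∃ b, x b ≠ x ⟨0, hk⟩ := by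
    by_contra! hcon
    exact hne ⟨_, hcon⟩
  obtain ⟨U, V, hU, hV, hbU, hV0, hUV⟩ := t2_separation hb
  let W : Fin k → Set X := fun j => if j = b then U else if j = ⟨0, hk⟩ then V else univ
  have hW : ∀ j, W j ∈ 𝓝 (x j) := by
    intro j
    simp only [W]
    split_ifs with h1 h2
    · exact h1 ▸ hU.mem_nhds hbU
    · exact h2 ▸ hV.mem_nhds hV0
    · exact univ_mem
  have hcl : ∀ j, ∃ B ∈ 𝓝 (x j), IsClosed B ∧ B ⊆ A j ∩ W j := fun j =>
    exists_mem_nhds_isClosed_subset (inter_mem (hA j) (hW j))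
  choose B hBn hBc hBA using hcl
  have hdisj : Disjoint (B b) (B ⟨0, hk⟩) := by
    have h0 : (⟨0, hk⟩ : Fin k) ≠ b := fun h => hb (by rw [h])
    refine hUV.mono ?_ ?_
    · exact (hBA b).trans (inter_subset_right.trans (by simp [W]))
    · exact (hBA _).trans (inter_subset_right.trans (by simp [W, h0]))
  obtain ⟨π, hπc, hπi, hπA, hπ1, hπ2⟩ := (hx B hBn).exists_cantor S.continuous_map hBc hdisj
  exact ⟨π, hπc, hπi, fun y => (hBA _ (hπA y)).1,
    fun m hm y => (S.mem_IE_iff hm _).2 fun V hV => hπ1 m y V hV, hπ2⟩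

/-- A system with a nondiagonal IE-tuple is Li–Yorke chaotic. -/
theorem DynSys.isLiYorkeChaotic_of_mem_IE (S : DynSys X) {k : ℕ} {x : Fin k → X} (hk : 0 < k)
    (hx : x ∈ S.IE k) (hne : ¬ ∃ a : X, ∀ j, x j = a) : IsLiYorkeChaotic S.map := by
  obtain ⟨π, -, hπi, -, -, hπ⟩ := S.exists_cantor hk hx hne (A := fun _ => univ)
    fun _ => univ_mem
  refine ⟨range π, fun hcount => ?_, ?_⟩
  · have h1 : (univ : Set (Fin k × (ℕ → Bool))).Countable :=
      countable_of_injective_of_countable_image hπi.injOn (by rwa [image_univ])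
    have h2 : Countable (ℕ → Bool) := by
      have := countable_univ_iff.1 h1
      exact Function.Injective.countable (f := fun z : ℕ → Bool => ((⟨0, hk⟩ : Fin k), z))
        fun z z' h => (Prod.ext_iff.1 h).2
    have h3 : Countable (Set ℕ) := by
      classical
      exact Function.Injective.countable (f := fun (s : Set ℕ) (n : ℕ) => decide (n ∈ s))
        fun s s' h => Set.ext fun n => by simpa using congrFun h n
    exact Function.cantor_injective (fun s : Set ℕ => (nonempty_encodable (Set ℕ)).some.encode s)
      (nonempty_encodable (Set ℕ)).some.encode_injective
  · rintro _ ⟨y, rfl⟩ _ ⟨z, rfl⟩ hyz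
    exact mem_liYorkePairs_of_approach hπi hπ fun h => hyz (by rw [h])

end

theorem mainTheorem3 {X : Type*} [MetricSpace X] [CompactSpace X] (S : DynSys X) :
    -- the theorem on Cantor sets
    (∀ (k : ℕ), 2 ≤ k → ∀ x : Fin k → X, x ∈ S.IE k → (¬ ∃ a : X, ∀ j, x j = a) →
      ∀ A : Fin k → Set X, (∀ j, A j ∈ 𝓝 (x j)) →
        ∃ Z : Fin k → Set X, (∀ j, IsCantorSet (Z j) ∧ Z j ⊆ A j) ∧
          (∀ m : ℕ, 0 < m → ∀ y : Fin m → X, (∀ i, y i ∈ ⋃ j, Z j) → y ∈ S.IE m) ∧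
          (∀ m : ℕ, 0 < m → ∀ y y' : Fin m → X, Function.Injective y →
            (∀ i, y i ∈ ⋃ j, Z j) → (∀ i, y' i ∈ ⋃ j, Z j) →
              liminf (fun n : ℕ => ⨆ i : Fin m, dist (S.map^[n] (y i)) (y' i)) atTop = 0)) ∧
    -- positive entropy implies Li-Yorke chaos
    (0 < topEntropy S.map → IsLiYorkeChaotic S.map) ∧
    -- the Li-Yorke IE-pairs form a dense subset of the set of nondiagonal IE-pairs
    (liYorkePairs S.map ∩ S.IEPairs ⊆ S.IEPairs \ Set.diagonal X ∧
      S.IEPairs \ Set.diagonal X ⊆ closure (liYorkePairs S.map ∩ S.IEPairs)) := by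
  refine ⟨fun k hk x hx hne A hA => ?_, fun hent => ?_, ?_, ?_⟩
  · obtain ⟨π, hπc, hπi, hπA, hπ1, hπ2⟩ := S.exists_cantor (by omega) hx hne hA
    refine ⟨fun j => range fun z => π (j, z), fun j => ⟨isCantorSet_range (hπc j)
      fun z z' h => (Prod.ext_iff.1 (hπi h)).2, ?_⟩, fun m hm y hy => ?_,
      fun m hm y y' hinj hy hy' => ?_⟩
    · rintro _ ⟨z, rfl⟩
      exact hπA (j, z)
    · have : ∀ i, ∃ v, π v = y i := fun i => by
        obtain ⟨j, z, hz⟩ := mem_iUnion.1 (hy i)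
        exact ⟨(j, z), hz⟩
      choose v hv using this
      obtain rfl : (fun i => π (v i)) = y := funext hv
      exact hπ1 m hm v
    · have h1 : ∀ i, ∃ v, π v = y i := fun i => by
        obtain ⟨j, z, hz⟩ := mem_iUnion.1 (hy i)
        exact ⟨(j, z), hz⟩
      have h2 : ∀ i, ∃ v, π v = y' i := fun i => by
        obtain ⟨j, z, hz⟩ := mem_iUnion.1 (hy' i)
        exact ⟨(j, z), hz⟩
      choose v hv using h1
      choose v' hv' using h2
      have : Nonempty (Fin m) := ⟨⟨0, hm⟩⟩
      have hvi : Function.Injective v := fun i j h => hinj (by rw [← hv, ← hv, h])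
      refine liminf_eq_zero_of_frequently_lt (C := Metric.diam (univ : Set X))
        (fun n => Real.iSup_nonneg fun i => dist_nonneg)
        (fun n => ciSup_le fun i => dist_le_diam_univ _ _) fun ε hε => ?_
      refine (hπ2 m v v' hvi (ε / 2) (by positivity)).mono fun n hn => ?_
      refine lt_of_le_of_lt (ciSup_le fun i => ?_) (half_lt_self hε)
      rw [← hv, ← hv']
      exact (hn i).le
  · obtain ⟨p, a, b, hab, hP⟩ := exists_posIndep_of_topEntropy_pos hent
    obtain ⟨x, hxA, hx⟩ := hP.exists_points (by
      intro i
      fin_cases i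
      · exact isClosed_le (by fun_prop) continuous_const
      · exact isClosed_le continuous_const (by fun_prop))
    refine S.isLiYorkeChaotic_of_mem_IE two_pos ((S.mem_IE_iff two_pos x).2 hx) ?_
    rintro ⟨c, hc⟩
    have h0 : dist (x 0) p ≤ a := hxA 0
    have h1 : b ≤ dist (x 1) p := hxA 1
    rw [hc] at h0 h1
    linarith
  · rintro ⟨x, y⟩ ⟨hLY, hIE⟩
    refine ⟨hIE, fun hxy => ?_⟩
    obtain rfl : x = y := hxy
    have := hLY.1
    simp at this
  · rintro ⟨x, y⟩ ⟨hIE, hne⟩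
    rw [mem_closure_iff_nhds]
    intro U hU
    obtain ⟨V, hV, W, hW, hVW⟩ := mem_nhds_prod_iff.1 hU
    obtain ⟨π, -, hπi, hπA, hπ1, hπ2⟩ := S.exists_cantor (x := ![x, y]) (A := ![V, W]) two_pos hIE
      (by rintro ⟨c, hc⟩; exact hne ((hc 0).trans (hc 1).symm))
      (by intro i; fin_cases i <;> simpa)
    let z : ℕ → Bool := fun _ => false
    -- One point from each Cantor set; distinct labels make the pair Li–Yorke, and (1) makes it an
    -- IE-pair.
    refine ⟨(π (0, z), π (1, z)), hVW ⟨hπA (0, z), hπA (1, z)⟩,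
      mem_liYorkePairs_of_approach hπi hπ2 (by simp), ?_⟩
    have h1 := hπ1 2 two_pos ![(0, z), (1, z)]
    have h2 : (fun i => π (![((0 : Fin 2), z), (1, z)] i)) = ![π (0, z), π (1, z)] := by
      funext i
      fin_cases i <;> rfl
    rw [h2] at h1
    exact h1
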